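/- For a class $A$ and a cardinal $\kappa$, an *$A$-extendibility embedding for $\kappa$ of degree $\lambda$*, where $\lambda>\kappa$ is an ordinal, is an elementary embedding $j:\langle V_\lambda,\in,A\cap V_\lambda\rangle\to\langle V_\theta,\in,A\cap V_\theta\rangle$, for some ordinal $\theta$, with critical point $\kappa$ and $\lambda<j(\kappa)$. The cardinal $\kappa$ is *$A$-extendible* if there is such an embedding of degree $\lambda$ for every ordinal $\lambda>\kappa$. A function $\ell:\kappa\to V_\kappa$ is an *$A$-extendibility Laver function for $\kappa$* if for every ordinal $\lambda>\kappa$ and every set $a$ there is an $A$-extendibility embedding $j$ for $\kappa$ of degree $\lambda$ with $j(\ell)(\kappa)=a$. **Theorem.** If $\kappa$ is $A$-extendible, then there is an $A$-extendibility Laver function $\ell:\kappa\to V_\kappa$ for $\kappa$. **Corollary.** In $\mathrm{GBC}$ (Gödel–Bernays set theory with the global axiom of choice), for every class $A$ there is a class function $\ell:\mathrm{Ord}\to V$ such that, whenever $\kappa$ is $A$-extendible, the restriction $\ell\restriction\kappa$ is an $A$-extendibility Laver function for $\kappa$. -/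

import Mathlib

universe u v

/-! Sets are the elements of `V = ZFSet.{u}`, classes are subsets `A : Set ZFSet.{u}`, and the ordinal
`α` is identified with the von Neumann ordinal `α.toZFSet`. -/

namespace AExt

open scoped ZFSet

/-- The relation symbols of the language of set theory expanded by class predicates: the binary
symbol `∈`, and a unary symbol for every index `i : ι`. -/
inductive SetRel (ι : Type v) : ℕ → Type v
  | mem : SetRel ι 2
  | cls : ι → SetRel ι 1

/-- The first-order language of set theory with class predicates indexed by `ι`. -/
def setLang (ι : Type v) : FirstOrder.Language.{0, v} :=
  ⟨fun _ => Empty, SetRel ι⟩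

/-- The rank-initial segment `V_λ`, as a type that remembers the predicate `A`, so that it can carry
the structure `⟨V_λ, ∈, A ∩ V_λ⟩`. -/
def VStr (_A : Set ZFSet.{u}) (l : Ordinal.{u}) : Type (u + 1) :=
  {x : ZFSet.{u} // x ∈ V_ l}

/-- The structure `⟨V_λ, ∈, A ∩ V_λ⟩`. -/
instance VStr.instStructure (A : Set ZFSet.{u}) (l : Ordinal.{u}) :
    (setLang Unit).Structure (VStr A l) where
  funMap f := Empty.elim f
  RelMap {_} r x :=
    match r, x with
    | SetRel.mem, x => (x 0).1 ∈ (x 1).1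
    | SetRel.cls _, x => (x 0).1 ∈ A

/-- The ordinal `α < λ` as an element of `V_λ`. -/
noncomputable def VStr.ord (A : Set ZFSet.{u}) {a l : Ordinal.{u}} (h : a < l) : VStr A l :=
  ⟨a.toZFSet, ZFSet.mem_vonNeumann.2 (by rwa [Ordinal.rank_toZFSet])⟩

/-- `j : ⟨V_λ, ∈, A ∩ V_λ⟩ → ⟨V_θ, ∈, A ∩ V_θ⟩`, an elementary embedding, is an `A`-extendibility
embedding for `κ` of degree `λ`: `κ < λ`, the critical point of `j` is `κ`, and `λ < j(κ)`. -/
structure IsExtEmb (A : Set ZFSet.{u}) (κ l θ : Ordinal.{u})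
    (j : (setLang Unit).ElementaryEmbedding (VStr A l) (VStr A θ)) : Prop where
  lt : κ < l
  fix_below : ∀ (a : Ordinal.{u}) (h : a < κ),
    (j (VStr.ord A (h.trans lt))).1 = a.toZFSet
  moves : (j (VStr.ord A lt)).1 ≠ κ.toZFSet
  degree_lt : l.toZFSet ∈ (j (VStr.ord A lt)).1

/-- The cardinal `κ` is `A`-extendible: for every `λ > κ` there are an ordinal `θ` and an
`A`-extendibility embedding `j : ⟨V_λ, ∈, A ∩ V_λ⟩ → ⟨V_θ, ∈, A ∩ V_θ⟩` for `κ` of degree `λ`. -/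
def IsExtendible (A : Set ZFSet.{u}) (κ : Ordinal.{u}) : Prop :=
  κ.IsInitial ∧
    ∀ l : Ordinal.{u}, κ < l →
      ∃ (θ : Ordinal.{u}) (j : (setLang Unit).ElementaryEmbedding (VStr A l) (VStr A θ)), IsExtEmb A κ l θ j

/-- The set `ℓ` is an `A`-extendibility Laver function for `κ`: it is a function `ℓ : κ → V_κ`, and for
every `λ > κ` and every set `a` there is an `A`-extendibility embedding `j` for `κ` of degree `λ` such
that `j(ℓ)(κ) = a` (with `ℓ` in the domain `V_λ` of `j`; since `ℓ` is a function, so is `j(ℓ)`). -/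
def IsLaver (A : Set ZFSet.{u}) (κ : Ordinal.{u}) (f : ZFSet.{u}) : Prop :=
  ZFSet.IsFunc κ.toZFSet (V_ κ) f ∧
    ∀ l : Ordinal.{u}, κ < l → ∀ a : ZFSet.{u},
      ∃ (θ : Ordinal.{u}) (j : (setLang Unit).ElementaryEmbedding (VStr A l) (VStr A θ)), IsExtEmb A κ l θ j ∧
        ∃ x : VStr A l, x.1 = f ∧ ZFSet.pair κ.toZFSet a ∈ (j x).1

/-- The universe of sets, as a type that remembers a family `𝒞` of classes. -/
def ClassUniv (_C : Set (Set ZFSet.{u})) : Type (u + 1) := ZFSet.{u}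

/-- The structure `⟨V, ∈, C⟩_{C ∈ 𝒞}`, with every class in `𝒞` as a predicate. -/
instance ClassUniv.instStructure (C : Set (Set ZFSet.{u})) :
    (setLang ↥C).Structure (ClassUniv C) where
  funMap f := Empty.elim f
  RelMap {_} r x :=
    match r, x with
    | SetRel.mem, x => (show ZFSet.{u} from x 0) ∈ (show ZFSet.{u} from x 1)
    | SetRel.cls c, x => (show ZFSet.{u} from x 0) ∈ c.1

/-- The graph of `F : V → V`, as a class of ordered pairs. -/
def graphV (F : ZFSet.{u} → ZFSet.{u}) : Set ZFSet.{u} :=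
  {p | ∃ x, p = ZFSet.pair x (F x)}

/-- The graph of `L : Ord → V`, as a class of ordered pairs. -/
def graphOrd (L : Ordinal.{u} → ZFSet.{u}) : Set ZFSet.{u} :=
  {p | ∃ α : Ordinal.{u}, p = ZFSet.pair α.toZFSet (L α)}

/-- The restriction `L ↾ κ` of `L : Ord → V`, as a set of ordered pairs. -/
noncomputable def restrict (L : Ordinal.{u} → ZFSet.{u}) (κ : Ordinal.{u}) : ZFSet.{u} :=
  ZFSet.range fun α : Set.Iio κ => ZFSet.pair α.1.toZFSet (L α.1)

/-- The universe `V` with the family `𝒞` as its classes satisfies Gödel-Bernays set theory with global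
choice: `𝒞` has every class that is first-order definable (quantifying over sets only) from set
parameters and members of `𝒞`, and `𝒞` has a global choice function. The set axioms and the
replacement axiom for classes hold for `V = ZFSet` with any family of classes. -/
structure IsGBC (C : Set (Set ZFSet.{u})) : Prop where
  comprehension : ∀ D : Set ZFSet.{u},
    Set.Definable₁ (M := ClassUniv C) Set.univ (setLang ↥C) D → D ∈ C
  global_choice : ∃ F : ZFSet.{u} → ZFSet.{u},
    graphV F ∈ C ∧ ∀ x : ZFSet.{u}, x.Nonempty → F x ∈ x

end AExt

namespace AExt

open FirstOrder FirstOrder.Language Order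
open scoped ZFSet

/-! The Laver function is built by recursion: `L γ` is picked by a global choice function among the
sets that `L ↾ γ` fails to anticipate at the least limit level where there is such a failure, and is
`∅` if nothing fails. Suppose `L ↾ κ` fails at `V_ρ`, and take an embedding `J` of degree `μ > ρ`.
By elementarity `b = J(L ↾ κ)(κ)` is a failure in the sense of `V_κ' = J(V_κ)`, at a least level
`V_ρ' ⊆ V_ρ`. But `J ↾ V_ρ'` is a set in `V_θ` that anticipates `b`. It need not lie in `V_κ'`;
however, successes with parameters in `V_κ` reflect into `V_κ`, and the image of this fact under `J`
brings the success down to `V_κ'`, a contradiction (`not_fails`). The reflection is again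
extendibility: an embedding whose degree exceeds the rank of a witness puts the witness inside
`J(V_κ)` (`success_of_success_univ`, `exists_fails_mem`).

The argument needs one formula saying that a set is an embedding. Instead of coding syntax inside
set theory, elementarity is replaced by preservation of the finitely many relations in `Prim`. If a
map of a limit level `V_ρ` preserves these and fixes `ω` and the natural numbers, then for `l < ρ`
it sends the set of sequences satisfying a given formula in `V_l` to the corresponding set for the
image of `V_l`. This goes by induction on the formula (`exists_codes`), and it makes the restriction
to `V_l` elementary. Conversely, an elementary map restricted to a smaller limit level preserves
`Prim` (`exists_anticipates`).

For the class version, the recursion step `StepRel` is single-valued and quantifies over sets only,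
so the graph of `L` is definable from `A` and the choice class (`mem_graphOrd_iff`). The version for
one cardinal is the case in which every subset of the universe counts as a class. -/

/-! ### Uniform first-order definability over transitive classes -/

/-- `e` identifies the structure `M` with `⟨U, ∈, cl⟩`, where `U` is a transitive class. -/
structure IsInterp {ι : Type v} (cl : ι → Set ZFSet.{u}) (U : Set ZFSet.{u}) (M : Type (u + 1))
    [(setLang ι).Structure M] (e : M → ZFSet.{u}) : Prop where
  inj : Function.Injective e
  range_eq : Set.range e = U
  trans : ∀ x ∈ U, ∀ y ∈ x, y ∈ U
  mem : ∀ x : Fin 2 → M,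
    Structure.RelMap (L := setLang ι) SetRel.mem x ↔ e (x 0) ∈ e (x 1)
  cls : ∀ (c : ι) (x : Fin 1 → M),
    Structure.RelMap (L := setLang ι) (SetRel.cls c) x ↔ e (x 0) ∈ cl c

/-- `P U v` is expressed over every transitive class `U` by one first-order formula. -/
class FDef {ι : Type v} (cl : ι → Set ZFSet.{u}) (P : Set ZFSet.{u} → (ℕ → ZFSet.{u}) → Prop) :
    Prop where
  out : ∃ φ : (setLang ι).Formula ℕ, ∀ (U : Set ZFSet.{u}) (M : Type (u + 1))
    [(setLang ι).Structure M] (e : M → ZFSet.{u}), IsInterp cl U M e →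
    ∀ v : ℕ → M, φ.Realize v ↔ P U (fun n => e (v n))

/-- A range of quantification: the whole class `U`, or the value of a variable. -/
class IsBound (B : Set ZFSet.{u} → (ℕ → ZFSet.{u}) → Set ZFSet.{u}) : Prop where
  out : B = (fun U _ => U) ∨ ∃ k, B = fun _ v => (v k : Set ZFSet.{u})

instance : IsBound.{u} fun U _ => U := ⟨.inl rfl⟩
instance (k : ℕ) : IsBound.{u} fun _ v => (v k : Set ZFSet.{u}) := ⟨.inr ⟨k, rfl⟩⟩

namespace FDef
variable {ι : Type v} {cl : ι → Set ZFSet.{u}}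
  {P Q : Set ZFSet.{u} → (ℕ → ZFSet.{u}) → Prop}

instance mem (i k : ℕ) : FDef cl fun _ v => v i ∈ v k :=
  ⟨Relations.formula₂ (SetRel.mem : (setLang ι).Relations 2) (Term.var i) (Term.var k), by
    intro U M _ e h v
    exact (Formula.realize_rel₂ (L := setLang ι)).trans (h.mem _)⟩

instance cls (c : ι) (i : ℕ) : FDef cl fun _ v => v i ∈ cl c :=
  ⟨Relations.formula₁ (SetRel.cls c : (setLang ι).Relations 1) (Term.var i), by
    intro U M _ e h v
    exact (Formula.realize_rel₁ (L := setLang ι)).trans (h.cls _ _)⟩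

instance eq (i k : ℕ) : FDef cl fun _ v => v i = v k :=
  ⟨Term.equal (Term.var i) (Term.var k), by
    intro U M _ e h v
    rw [Formula.realize_equal]
    exact h.inj.eq_iff.symm⟩

instance not [hP : FDef cl P] : FDef cl fun U v => ¬ P U v := by
  obtain ⟨φ, hφ⟩ := hP
  exact ⟨φ.not, fun U M _ e h v => by rw [Formula.realize_not, hφ U M e h]⟩

instance imp [hP : FDef cl P] [hQ : FDef cl Q] : FDef cl fun U v => P U v → Q U v := by
  obtain ⟨φ, hφ⟩ := hP
  obtain ⟨ψ, hψ⟩ := hQ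
  exact ⟨φ.imp ψ, fun U M _ e h v => by
    rw [← hφ U M e h, ← hψ U M e h]; exact BoundedFormula.realize_imp⟩

theorem of_iff [hP : FDef cl P] (h : ∀ U v, Q U v ↔ P U v) : FDef cl Q := by
  have : Q = P := by ext U v; exact h U v
  exact this ▸ hP

instance and [FDef cl P] [FDef cl Q] : FDef cl fun U v => P U v ∧ Q U v :=
  of_iff (P := fun U v => ¬ (P U v → ¬ Q U v)) fun U v => by tauto

instance or [FDef cl P] [FDef cl Q] : FDef cl fun U v => P U v ∨ Q U v :=
  of_iff (P := fun U v => ¬ P U v → Q U v) fun U v => by tauto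

instance iff [FDef cl P] [FDef cl Q] : FDef cl fun U v => P U v ↔ Q U v :=
  of_iff (P := fun U v => (P U v → Q U v) ∧ (Q U v → P U v)) fun U v => by tauto

/-- The bound variable takes slot `0` and the others are shifted, so nested quantifiers are handled
by repeated instance search. -/
instance ex_univ {R : Set ZFSet.{u} → ZFSet.{u} → (ℕ → ZFSet.{u}) → Prop}
    [hR : FDef cl fun U v => R U (v 0) fun n => v (n + 1)] :
    FDef cl fun U v => ∃ x ∈ U, R U x v := by
  obtain ⟨φ, hφ⟩ := hR
  let g : ℕ → ℕ ⊕ Fin 1 := fun n => Nat.casesOn n (Sum.inr 0) Sum.inl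
  refine ⟨(BoundedFormula.relabel g φ : (setLang ι).BoundedFormula ℕ 1).ex, ?_⟩
  intro U M _ e h v
  have key : ∀ a : M, (BoundedFormula.relabel g φ : (setLang ι).BoundedFormula ℕ 1).Realize v
      (Fin.snoc default a) ↔ R U (e a) fun n => e (v n) := by
    intro a
    have hv := hφ U M e h (fun n => Nat.casesOn n a v)
    refine Iff.trans ?_ hv
    rw [BoundedFormula.realize_relabel, Formula.Realize]
    apply iff_of_eq
    congr 1
    · funext n
      cases n with
      | zero => simp [g, Fin.snoc]
      | succ n => simp [g]
    · exact Subsingleton.elim _ _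
  refine Iff.trans BoundedFormula.realize_ex ?_
  constructor
  · rintro ⟨a, ha⟩
    exact ⟨e a, h.range_eq ▸ ⟨a, rfl⟩, (key a).1 ha⟩
  · rintro ⟨x, hx, hR⟩
    rw [← h.range_eq] at hx
    obtain ⟨a, rfl⟩ := hx
    exact ⟨a, (key a).2 hR⟩

/-- Formulas only matter over classes that contain the values of the variables. -/
theorem of_iff_of_mem [hP : FDef cl P]
    (h : ∀ U : Set ZFSet.{u}, (∀ x ∈ U, ∀ y ∈ x, y ∈ U) → ∀ v, (∀ n, v n ∈ U) → (Q U v ↔ P U v)) :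
    FDef cl Q := by
  obtain ⟨φ, hφ⟩ := hP
  exact ⟨φ, fun U M _ e hU v => by
    rw [hφ U M e hU]
    exact (h U hU.trans _ fun n => hU.range_eq ▸ ⟨v n, rfl⟩).symm⟩

variable {R : Set ZFSet.{u} → ZFSet.{u} → (ℕ → ZFSet.{u}) → Prop}

/-- Transitivity of `U` makes the quantifier over elements of `v k` a restricted quantifier over
`U`. -/
instance ex_mem (k : ℕ) [hR : FDef cl fun U v => R U (v 0) fun n => v (n + 1)] :
    FDef cl fun U v => ∃ x ∈ v k, R U x v :=
  of_iff_of_mem (P := fun U v => ∃ x ∈ U, x ∈ v k ∧ R U x v)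
    fun _ hU v hv => ⟨fun ⟨x, hx, h⟩ => ⟨x, hU _ (hv k) _ hx, hx, h⟩, fun ⟨x, _, h⟩ => ⟨x, h⟩⟩

instance ex_coe (k : ℕ) [hR : FDef cl fun U v => R U (v 0) fun n => v (n + 1)] :
    FDef cl fun U v => ∃ x ∈ (v k : Set ZFSet.{u}), R U x v :=
  ex_mem k

instance all_univ [hR : FDef cl fun U v => R U (v 0) fun n => v (n + 1)] :
    FDef cl fun U v => ∀ x ∈ U, R U x v :=
  of_iff (P := fun U v => ¬ ∃ x ∈ U, ¬ R U x v) fun U v => by push Not; rfl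

instance all_mem (k : ℕ) [hR : FDef cl fun U v => R U (v 0) fun n => v (n + 1)] :
    FDef cl fun U v => ∀ x ∈ v k, R U x v :=
  of_iff (P := fun U v => ¬ ∃ x ∈ v k, ¬ R U x v) fun U v => by push Not; rfl

instance all_coe (k : ℕ) [hR : FDef cl fun U v => R U (v 0) fun n => v (n + 1)] :
    FDef cl fun U v => ∀ x ∈ (v k : Set ZFSet.{u}), R U x v :=
  all_mem k

end FDef

/-! ### Definability of levels, ordinals, pairs and functions -/

/-- `x` is a level of the cumulative hierarchy, as witnessed in `U` by the set of smaller levels. -/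
def Level (U : Set ZFSet.{u}) (x : ZFSet.{u}) : Prop :=
  ∃ h ∈ U, (∀ v ∈ h, ∀ z ∈ U, z ∈ v ↔ ∃ y ∈ h, y ∈ v ∧ ∀ w ∈ z, w ∈ y) ∧
    ∀ z ∈ U, z ∈ x ↔ ∃ y ∈ h, ∀ w ∈ z, w ∈ y

instance FDef.level {ι : Type v} (cl : ι → Set ZFSet.{u})
    (B : Set ZFSet.{u} → (ℕ → ZFSet.{u}) → Set ZFSet.{u}) [hB : IsBound B] (i : ℕ) :
    FDef cl fun U v => Level (B U v) (v i) := by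
  obtain rfl | ⟨k, rfl⟩ := hB.out <;> unfold Level <;> infer_instance

section
variable {ι : Type v} {cl : ι → Set ZFSet.{u}}

instance FDef.subset (i k : ℕ) : FDef cl fun _ v => v i ⊆ v k :=
  of_iff (P := fun _ v => ∀ x ∈ v i, x ∈ v k) fun _ _ => Iff.rfl

instance FDef.eq_empty (i : ℕ) : FDef cl fun _ v => v i = ∅ :=
  of_iff (P := fun _ v => ∀ x ∈ v i, ¬ x = x) fun _ v => by simp [ZFSet.eq_empty]

instance FDef.isOrdinal (i : ℕ) : FDef cl fun _ v => (v i).IsOrdinal :=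
  of_iff (P := fun _ v => (∀ x ∈ v i, x ⊆ v i) ∧ ∀ x ∈ v i, ∀ y ∈ x, y ⊆ x)
    fun _ v => ZFSet.isOrdinal_iff_forall_mem_isTransitive

/-- All quantifiers are bounded by `p` and its elements, so the notion means the same over every
transitive class. -/
theorem eq_pair_iff {p x y : ZFSet.{u}} : p = ZFSet.pair x y ↔
    ∃ a ∈ p, ∃ b ∈ p, (x ∈ a ∧ ∀ z ∈ a, z = x) ∧ (x ∈ b ∧ y ∈ b ∧ ∀ z ∈ b, z = x ∨ z = y) ∧
      ∀ z ∈ p, z = a ∨ z = b := by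
  constructor
  · rintro rfl
    exact ⟨{x}, by simp [ZFSet.pair], {x, y}, by simp [ZFSet.pair], by simp, by simp,
      by simp [ZFSet.pair]⟩
  · rintro ⟨a, ha, b, hb, ⟨h1, h2⟩, ⟨h3, h4, h5⟩, h6⟩
    have ea : a = {x} := by
      ext z; simp only [ZFSet.mem_singleton]
      exact ⟨h2 z, by rintro rfl; exact h1⟩
    have eb : b = {x, y} := by
      ext z; simp only [ZFSet.mem_pair]
      exact ⟨h5 z, by rintro (rfl | rfl); exacts [h3, h4]⟩
    ext z
    simp only [ZFSet.pair, ZFSet.mem_pair, ← ea, ← eb]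
    exact ⟨h6 z, by rintro (rfl | rfl); exacts [ha, hb]⟩

instance FDef.eq_pair (i k l : ℕ) : FDef cl fun _ v => v i = ZFSet.pair (v k) (v l) :=
  of_iff fun _ _ => eq_pair_iff

instance FDef.pair_mem (i k l : ℕ) : FDef cl fun _ v => ZFSet.pair (v k) (v l) ∈ v i :=
  of_iff (P := fun _ v => ∃ p ∈ v i, p = ZFSet.pair (v k) (v l)) fun _ v => by simp

theorem isFunc_iff {x y f : ZFSet.{u}} : ZFSet.IsFunc x y f ↔
    (∀ p ∈ f, ∃ a ∈ x, ∃ b ∈ y, p = ZFSet.pair a b) ∧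
      ∀ z ∈ x, ∃ w ∈ y, ZFSet.pair z w ∈ f ∧ ∀ w' ∈ y, ZFSet.pair z w' ∈ f → w' = w := by
  constructor
  · rintro ⟨h1, h2⟩
    refine ⟨fun p hp => ZFSet.mem_prod.1 (h1 hp), fun z hz => ?_⟩
    obtain ⟨w, hw, hu⟩ := h2 z hz
    exact ⟨w, (ZFSet.pair_mem_prod.1 (h1 hw)).2, hw, fun w' _ h => hu w' h⟩
  · rintro ⟨h1, h2⟩
    have hs : f ⊆ ZFSet.prod x y := fun p hp => ZFSet.mem_prod.2 (h1 p hp)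
    refine ⟨hs, fun z hz => ?_⟩
    obtain ⟨w, _, hw, hu⟩ := h2 z hz
    exact ⟨w, hw, fun w' h => hu w' (ZFSet.pair_mem_prod.1 (hs h)).2 h⟩

instance FDef.isFunc (i k l : ℕ) : FDef cl fun _ v => ZFSet.IsFunc (v i) (v k) (v l) :=
  of_iff fun _ _ => isFunc_iff

end

/-! ### Primitive relations and anticipation -/

/-- Names of the finitely many relations that generate satisfaction in set-sized structures. -/
inductive Prim
  | eq | mem | notMem | pair | level | funs | atomMem | atomEq | atomCls | bot | imp | all

/-- The relations named by `Prim`, evaluated in the structure `⟨U, ∈, A⟩`. -/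
def Prim.Holds (A : Set ZFSet.{u}) (U : Set ZFSet.{u}) (a b c d e : ZFSet.{u}) : Prim → Prop
  | eq => a = b
  | mem => a ∈ b
  | notMem => ¬ a ∈ b
  | pair => a = ZFSet.pair b c
  | level => Level U a
  | funs => ∀ s ∈ U, s ∈ a ↔ ZFSet.IsFunc b c s
  -- In the clauses from here on, `b` is meant as the set of all sequences and `a` as the set of
  -- those satisfying a formula. Positions are `c`, `d` in the atomic clauses; in `all`, `d` is the
  -- quantified position and `e` the set of all positions.
  | atomMem => ∀ s ∈ b, s ∈ a ↔
      ∃ x ∈ U, ∃ y ∈ U, ZFSet.pair c x ∈ s ∧ ZFSet.pair d y ∈ s ∧ x ∈ y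
  | atomEq => ∀ s ∈ b, s ∈ a ↔ ∃ x ∈ U, ZFSet.pair c x ∈ s ∧ ZFSet.pair d x ∈ s
  | atomCls => ∀ s ∈ b, s ∈ a ↔ ∃ x ∈ U, ZFSet.pair c x ∈ s ∧ x ∈ A
  | bot => ∀ s ∈ b, ¬ s ∈ a
  | imp => ∀ s ∈ b, s ∈ a ↔ (s ∈ c → s ∈ d)
  | all => ∀ s ∈ b, s ∈ a ↔
      ∀ t ∈ b, (∀ k ∈ e, ¬ k = d → ∀ x ∈ U, ZFSet.pair k x ∈ s → ZFSet.pair k x ∈ t) → t ∈ c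

section
variable {ι : Type v} {cl : ι → Set ZFSet.{u}}

instance FDef.holds (t : Prim) (cA : ι) (B : Set ZFSet.{u} → (ℕ → ZFSet.{u}) → Set ZFSet.{u})
    [hB : IsBound B] (i k l m n : ℕ) :
    FDef cl fun U v => t.Holds (cl cA) (B U v) (v i) (v k) (v l) (v m) (v n) := by
  obtain rfl | ⟨r, rfl⟩ := hB.out <;> cases t <;> unfold Prim.Holds <;> infer_instance

end

/-- `j` preserves the relation `t` from `⟨X, ∈, A⟩` to `⟨Y, ∈, A⟩`. -/
def Prim.Preserved (A : Set ZFSet.{u}) (X Y j : ZFSet.{u}) (t : Prim) : Prop :=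
  ∀ a ∈ X, ∀ b ∈ X, ∀ c ∈ X, ∀ d ∈ X, ∀ e ∈ X, t.Holds A X a b c d e →
    ∀ a' ∈ Y, ∀ b' ∈ Y, ∀ c' ∈ Y, ∀ d' ∈ Y, ∀ e' ∈ Y,
      ZFSet.pair a a' ∈ j → ZFSet.pair b b' ∈ j → ZFSet.pair c c' ∈ j → ZFSet.pair d d' ∈ j →
        ZFSet.pair e e' ∈ j → t.Holds A Y a' b' c' d' e'

/-- Every element of `X` is an element of an element of `X`. -/
def NoMax (X : ZFSet.{u}) : Prop := ∀ x ∈ X, ∃ y ∈ X, x ∈ y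

/-- The set `j` is a map from `X` to `Y` that preserves the relations named by `Prim`, fixes the
elements of `g`, moves `g` above all ordinals of `X`, and satisfies `j(f)(g) = a`. -/
structure Anticipates (A : Set ZFSet.{u}) (g f X a Y j : ZFSet.{u}) : Prop where
  noMax : NoMax Y
  total : ∀ x ∈ X, ∃ y ∈ Y, ZFSet.pair x y ∈ j
  preserved : ∀ t : Prim, t.Preserved A X Y j
  fix : ∀ x ∈ g, ZFSet.pair x x ∈ j
  moves : ∃ g' ∈ Y, ZFSet.pair g g' ∈ j ∧ ∀ x ∈ X, x.IsOrdinal → x ∈ g'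
  value : ∃ f' ∈ Y, ZFSet.pair f f' ∈ j ∧ ZFSet.pair g a ∈ f'

/-- Some embedding in `U` of `X` into a level anticipates `a`. -/
def Success (A U : Set ZFSet.{u}) (g f X a : ZFSet.{u}) : Prop :=
  ∃ Y ∈ U, ∃ j ∈ U, Level U Y ∧ Anticipates A g f X a Y j

/-- `X` is a limit level, and no embedding in `U` of `X` into a level anticipates `a`. -/
def Fails (A U : Set ZFSet.{u}) (g f X a : ZFSet.{u}) : Prop :=
  Level U X ∧ NoMax X ∧ g ∈ X ∧ f ∈ X ∧ a ∈ X ∧ ¬ Success A U g f X a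

section
variable {ι : Type v} {cl : ι → Set ZFSet.{u}}

instance FDef.preserved (t : Prim) (cA : ι) (i k l : ℕ) :
    FDef cl fun _ v => t.Preserved (cl cA) (v i) (v k) (v l) := by
  unfold Prim.Preserved; infer_instance

instance FDef.noMax (i : ℕ) : FDef cl fun _ v => NoMax (v i) := by
  unfold NoMax; infer_instance

/-- `Prim` is finite, so quantifying over it is a conjunction. -/
instance FDef.all_prim {P : Prim → Set ZFSet.{u} → (ℕ → ZFSet.{u}) → Prop}
    [h : ∀ t, FDef cl (P t)] : FDef cl fun U v => ∀ t, P t U v :=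
  of_iff (P := fun U v => P .eq U v ∧ P .mem U v ∧ P .notMem U v ∧ P .pair U v ∧ P .level U v ∧ P .funs U v ∧
    P .atomMem U v ∧ P .atomEq U v ∧ P .atomCls U v ∧ P .bot U v ∧ P .imp U v ∧ P .all U v)
    fun U v => ⟨fun h => ⟨h _, h _, h _, h _, h _, h _, h _, h _, h _, h _, h _, h _⟩, by
      rintro ⟨_, _, _, _, _, _, _, _, _, _, _, _⟩ (_ | _) <;> assumption⟩

instance FDef.anticipates (cA : ι) (i k l m n r : ℕ) :
    FDef cl fun _ v => Anticipates (cl cA) (v i) (v k) (v l) (v m) (v n) (v r) :=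
  of_iff (P := fun _ v => NoMax (v n) ∧ (∀ x ∈ v l, ∃ y ∈ v n, ZFSet.pair x y ∈ v r) ∧
    (∀ t : Prim, t.Preserved (cl cA) (v l) (v n) (v r)) ∧ (∀ x ∈ v i, ZFSet.pair x x ∈ v r) ∧
    (∃ g' ∈ v n, ZFSet.pair (v i) g' ∈ v r ∧ ∀ x ∈ v l, x.IsOrdinal → x ∈ g') ∧
    (∃ f' ∈ v n, ZFSet.pair (v k) f' ∈ v r ∧ ZFSet.pair (v i) (v m) ∈ f'))
    fun _ v => ⟨fun ⟨h1, h2, h3, h4, h5, h6⟩ => ⟨h1, h2, h3, h4, h5, h6⟩,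
      fun ⟨h1, h2, h3, h4, h5, h6⟩ => ⟨h1, h2, h3, h4, h5, h6⟩⟩

instance FDef.success (cA : ι) (B : Set ZFSet.{u} → (ℕ → ZFSet.{u}) → Set ZFSet.{u})
    [hB : IsBound B] (i k l m : ℕ) :
    FDef cl fun U v => Success (cl cA) (B U v) (v i) (v k) (v l) (v m) := by
  obtain rfl | ⟨r, rfl⟩ := hB.out <;> unfold Success <;> infer_instance

instance FDef.fails (cA : ι) (B : Set ZFSet.{u} → (ℕ → ZFSet.{u}) → Set ZFSet.{u})
    [hB : IsBound B] (i k l m : ℕ) :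
    FDef cl fun U v => Fails (cl cA) (B U v) (v i) (v k) (v l) (v m) := by
  obtain rfl | ⟨r, rfl⟩ := hB.out <;> unfold Fails <;> infer_instance

section
variable (A : Set ZFSet.{u}) (B : Set ZFSet.{u} → (ℕ → ZFSet.{u}) → Set ZFSet.{u}) [IsBound B]

instance FDef.holds_const (t : Prim) (i k l m n : ℕ) : FDef (fun _ : Unit => A) fun U v =>
    t.Holds A (B U v) (v i) (v k) (v l) (v m) (v n) :=
  FDef.holds (cl := fun _ : Unit => A) t () B i k l m n

instance FDef.success_const (i k l m : ℕ) : FDef (fun _ : Unit => A) fun U v =>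
    Success A (B U v) (v i) (v k) (v l) (v m) :=
  FDef.success (cl := fun _ : Unit => A) () B i k l m

instance FDef.fails_const (i k l m : ℕ) : FDef (fun _ : Unit => A) fun U v =>
    Fails A (B U v) (v i) (v k) (v l) (v m) :=
  FDef.fails (cl := fun _ : Unit => A) () B i k l m

end

end

/-! ### Rank-closed universes and absoluteness of levels -/

/-- A class of sets cut off at a limit rank, or not at all. -/
structure RankUniv (U : Set ZFSet.{u}) : Prop where
  nonempty : U.Nonempty
  closed : ∀ x ∈ U, ∀ y : ZFSet.{u}, y.rank ≤ x.rank + 1 → y ∈ U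

namespace RankUniv
variable {U : Set ZFSet.{u}} (hU : RankUniv U)
include hU

theorem of_rank_le {x y : ZFSet.{u}} (hx : x ∈ U) (h : y.rank ≤ x.rank) : y ∈ U :=
  hU.closed x hx y (h.trans (le_add_of_nonneg_right zero_le_one))

theorem trans {x y : ZFSet.{u}} (hx : x ∈ U) (h : y ∈ x) : y ∈ U :=
  hU.of_rank_le hx (ZFSet.rank_lt_of_mem h).le

theorem subset {x y : ZFSet.{u}} (hx : x ∈ U) (h : y ⊆ x) : y ∈ U :=
  hU.of_rank_le hx (ZFSet.rank_mono h)

theorem powerset {x : ZFSet.{u}} (hx : x ∈ U) : x.powerset ∈ U :=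
  hU.closed x hx _ (by rw [ZFSet.rank_powerset, succ_eq_add_one])

theorem union {x y : ZFSet.{u}} (hx : x ∈ U) (hy : y ∈ U) : x ∪ y ∈ U := by
  rcases le_total x.rank y.rank with h | h
  · exact hU.of_rank_le hy (by simp [ZFSet.rank_union, h])
  · exact hU.of_rank_le hx (by simp [ZFSet.rank_union, h])

theorem prod {x y : ZFSet.{u}} (hx : x ∈ U) (hy : y ∈ U) : ZFSet.prod x y ∈ U :=
  hU.subset (hU.powerset (hU.powerset (hU.union hx hy))) (by
    rw [ZFSet.prod, ZFSet.pairSep]; exact ZFSet.sep_subset)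

theorem pair {x y : ZFSet.{u}} (hx : x ∈ U) (hy : y ∈ U) : ZFSet.pair x y ∈ U := by
  have h : ∀ z ∈ U, ({z} : ZFSet.{u}) ∈ U := fun z hz =>
    hU.closed z hz _ (by rw [ZFSet.rank_singleton, succ_eq_add_one])
  exact hU.trans (hU.prod (h x hx) (h y hy)) (ZFSet.pair_mem_prod.2 (by simp))

theorem funs {x y : ZFSet.{u}} (hx : x ∈ U) (hy : y ∈ U) : ZFSet.funs x y ∈ U :=
  hU.subset (hU.powerset (hU.prod hx hy)) (by rw [ZFSet.funs]; exact ZFSet.sep_subset)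

end RankUniv

theorem rankUniv_univ : RankUniv (Set.univ : Set ZFSet.{u}) :=
  ⟨⟨∅, trivial⟩, fun _ _ _ _ => trivial⟩

theorem rankUniv_of_isSuccLimit {o : Ordinal.{u}} (h : IsSuccLimit o) :
    RankUniv (V_ o : Set ZFSet.{u}) := by
  constructor
  · refine ⟨∅, ?_⟩
    rw [SetLike.mem_coe, ZFSet.mem_vonNeumann, ZFSet.rank_empty]
    exact h.bot_lt
  · intro x hx y hy
    rw [SetLike.mem_coe, ZFSet.mem_vonNeumann] at *
    exact hy.trans_lt (h.add_one_lt hx)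

theorem isSuccLimit_of_noMax {o : Ordinal.{u}} (h0 : 0 < o) (h : NoMax (V_ o)) :
    IsSuccLimit o := by
  refine ⟨by rw [isMin_iff_eq_bot]; exact h0.ne', ?_⟩
  rw [isSuccPrelimit_iff_succ_lt]
  intro b hb
  obtain ⟨y, hy, hby⟩ := h _ (ZFSet.vonNeumann_mem_of_lt hb)
  rw [ZFSet.mem_vonNeumann] at hy
  have := ZFSet.rank_lt_of_mem hby
  rw [ZFSet.rank_vonNeumann] at this
  exact (succ_le_of_lt this).trans_lt hy

theorem noMax_of_isSuccLimit {o : Ordinal.{u}} (h : IsSuccLimit o) : NoMax (V_ o) := by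
  intro x hx
  refine ⟨{x}, ?_, by simp⟩
  rw [ZFSet.mem_vonNeumann] at *
  rw [ZFSet.rank_singleton]
  exact h.succ_lt hx

/-- If `z` has rank below `x`, some `w ∈ x` has rank at least that of `z`. The level `y ⊇ w` then
also includes `z`, which puts `z` in `x`. -/
theorem eq_vonNeumann_of_forall_mem_iff {U : Set ZFSet.{u}} (hU : RankUniv U) {x : ZFSet.{u}}
    (hx : x ∈ U) {p : ZFSet.{u} → Prop} (hp : ∀ y, p y → y ∈ U ∧ y = V_ y.rank)
    (h : ∀ z ∈ U, z ∈ x ↔ ∃ y, p y ∧ z ⊆ y) : x = V_ x.rank := by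
  ext z
  rw [ZFSet.mem_vonNeumann]
  refine ⟨ZFSet.rank_lt_of_mem, fun hz => ?_⟩
  obtain ⟨w, hw, hzw⟩ := ZFSet.lt_rank_iff.1 hz
  obtain ⟨y, hy, hwy⟩ := (h w (hU.trans hx hw)).1 hw
  obtain ⟨hyU, hyV⟩ := hp y hy
  have hzy : z ⊆ y := by
    rw [hyV, ZFSet.subset_vonNeumann]
    exact hzw.trans (ZFSet.rank_mono hwy)
  exact (h z (hU.subset hyU hzy)).2 ⟨y, hy, hzy⟩

/-- Forwards, `∈`-induction shows that every element of the witness is a level. Backwards, the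
witness is the set of all `V_b` with `b` below the rank. -/
theorem level_iff {U : Set ZFSet.{u}} (hU : RankUniv U) {x : ZFSet.{u}} (hx : x ∈ U) :
    Level U x ↔ x = V_ x.rank := by
  constructor
  · rintro ⟨h, hh, h1, h2⟩
    have key : ∀ v, v ∈ h → v = V_ v.rank := by
      intro v
      induction v using ZFSet.inductionOn with
      | _ v ih =>
        intro hv
        refine eq_vonNeumann_of_forall_mem_iff hU (hU.trans hh hv) (p := fun y => y ∈ h ∧ y ∈ v)
          (fun y hy => ⟨hU.trans hh hy.1, ih y hy.2 hy.1⟩) fun z hz => ?_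
        rw [h1 v hv z hz]
        exact ⟨fun ⟨y, a, b, c⟩ => ⟨y, ⟨a, b⟩, c⟩, fun ⟨y, ⟨a, b⟩, c⟩ => ⟨y, a, b, c⟩⟩
    exact eq_vonNeumann_of_forall_mem_iff hU hx (p := (· ∈ h))
      (fun y hy => ⟨hU.trans hh hy, key y hy⟩) fun z hz => h2 z hz
  · intro hV
    have hm : ∀ y, y ∈ (V_ x.rank).sep (fun y => ∃ b, y = V_ b) ↔ ∃ b < x.rank, y = V_ b := by
      intro y
      rw [ZFSet.mem_sep]
      constructor
      · rintro ⟨h, b, rfl⟩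
        exact ⟨b, ZFSet.vonNeumann_mem_vonNeumann_iff.1 h, rfl⟩
      · rintro ⟨b, h, rfl⟩
        exact ⟨ZFSet.vonNeumann_mem_of_lt h, b, rfl⟩
    refine ⟨(V_ x.rank).sep fun y => ∃ b, y = V_ b, hU.subset hx ?_, ?_, ?_⟩
    · conv_rhs => rw [hV]
      exact ZFSet.sep_subset
    · intro v hv z _
      obtain ⟨b, hb, rfl⟩ := (hm v).1 hv
      rw [ZFSet.mem_vonNeumann']
      constructor
      · rintro ⟨a, ha, hz⟩
        exact ⟨V_ a, (hm _).2 ⟨a, ha.trans hb, rfl⟩, ZFSet.vonNeumann_mem_of_lt ha, hz⟩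
      · rintro ⟨y, hy, hyb, hz⟩
        obtain ⟨a, _, rfl⟩ := (hm y).1 hy
        exact ⟨a, ZFSet.vonNeumann_mem_vonNeumann_iff.1 hyb, hz⟩
    · intro z _
      rw [hV, ZFSet.mem_vonNeumann', ← hV]
      constructor
      · rintro ⟨a, ha, hz⟩
        exact ⟨V_ a, (hm _).2 ⟨a, ha, rfl⟩, hz⟩
      · rintro ⟨y, hy, hz⟩
        obtain ⟨a, ha, rfl⟩ := (hm y).1 hy
        exact ⟨a, ha, hz⟩

/-! ### Elementary maps between rank-initial segments -/

/-- The map `J` restricts to an elementary embedding of `⟨V_μ, ∈, A⟩` into `⟨V_θ, ∈, A⟩`. -/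
structure ElemMap (A : Set ZFSet.{u}) (μ θ : Ordinal.{u}) (J : ZFSet.{u} → ZFSet.{u}) : Prop where
  maps : ∀ x ∈ V_ μ, J x ∈ V_ θ
  transfer : ∀ P : Set ZFSet.{u} → (ℕ → ZFSet.{u}) → Prop, FDef (fun _ : Unit => A) P →
    ∀ v : ℕ → ZFSet.{u}, (∀ n, v n ∈ V_ μ) → (P (V_ μ) v ↔ P (V_ θ) fun n => J (v n))

theorem isInterp_vStr (A : Set ZFSet.{u}) (l : Ordinal.{u}) :
    IsInterp (fun _ : Unit => A) (V_ l : Set ZFSet.{u}) (VStr A l) Subtype.val where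
  inj := Subtype.val_injective
  range_eq := Subtype.range_coe_subtype
  trans x hx y hy := ZFSet.isTransitive_vonNeumann l x hx hy
  mem _ := Iff.rfl
  cls _ _ := Iff.rfl

open Classical in
/-- The function on sets induced by a map between rank-initial segments. -/
noncomputable def extendMap {A : Set ZFSet.{u}} {μ θ : Ordinal.{u}} (j : VStr A μ → VStr A θ)
    (x : ZFSet.{u}) : ZFSet.{u} :=
  if h : x ∈ V_ μ then (j ⟨x, h⟩).1 else ∅

theorem extendMap_of_mem {A : Set ZFSet.{u}} {μ θ : Ordinal.{u}} (j : VStr A μ → VStr A θ)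
    {x : ZFSet.{u}} (h : x ∈ V_ μ) : extendMap j x = (j ⟨x, h⟩).1 := dif_pos h

theorem elemMap_extendMap {A : Set ZFSet.{u}} {μ θ : Ordinal.{u}}
    (j : (setLang Unit).ElementaryEmbedding (VStr A μ) (VStr A θ)) :
    ElemMap A μ θ (extendMap j) where
  maps x hx := by rw [extendMap_of_mem _ hx]; exact (j ⟨x, hx⟩).2
  transfer P hP v hv := by
    obtain ⟨φ, hφ⟩ := hP
    have h1 := hφ _ _ _ (isInterp_vStr A μ) fun n => ⟨v n, hv n⟩
    have h2 := hφ _ _ _ (isInterp_vStr A θ) fun n => j ⟨v n, hv n⟩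
    have h3 : (fun n => extendMap j (v n)) = fun n => (j ⟨v n, hv n⟩).1 :=
      funext fun n => extendMap_of_mem _ (hv n)
    rw [h3]
    exact h1.symm.trans ((j.map_formula φ _).symm.trans h2)

namespace ElemMap
variable {A : Set ZFSet.{u}} {μ θ : Ordinal.{u}} {J : ZFSet.{u} → ZFSet.{u}}
  (hJ : ElemMap A μ θ J)
include hJ

theorem transfer₆ (P : Set ZFSet.{u} → ZFSet.{u} → ZFSet.{u} → ZFSet.{u} → ZFSet.{u} → ZFSet.{u} →
    ZFSet.{u} → Prop)
    [h : FDef (fun _ : Unit => A) fun U v => P U (v 0) (v 1) (v 2) (v 3) (v 4) (v 5)]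
    {a b c d e f : ZFSet.{u}} (ha : a ∈ V_ μ) (hb : b ∈ V_ μ) (hc : c ∈ V_ μ) (hd : d ∈ V_ μ)
    (he : e ∈ V_ μ) (hf : f ∈ V_ μ) :
    P (V_ μ) a b c d e f ↔ P (V_ θ) (J a) (J b) (J c) (J d) (J e) (J f) := by
  refine hJ.transfer _ h
    (fun n => match n with | 0 => a | 1 => b | 2 => c | 3 => d | 4 => e | _ => f) ?_
  intro n
  match n with
  | 0 => exact ha
  | 1 => exact hb
  | 2 => exact hc
  | 3 => exact hd
  | 4 => exact he
  | _ + 5 => exact hf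

theorem transfer₄ (P : Set ZFSet.{u} → ZFSet.{u} → ZFSet.{u} → ZFSet.{u} → ZFSet.{u} → Prop)
    [h : FDef (fun _ : Unit => A) fun U v => P U (v 0) (v 1) (v 2) (v 3)]
    {a b c d : ZFSet.{u}} (ha : a ∈ V_ μ) (hb : b ∈ V_ μ) (hc : c ∈ V_ μ) (hd : d ∈ V_ μ) :
    P (V_ μ) a b c d ↔ P (V_ θ) (J a) (J b) (J c) (J d) :=
  hJ.transfer₆ (fun U a b c d _ _ => P U a b c d) ha hb hc hd hd hd

theorem transfer₃ (P : Set ZFSet.{u} → ZFSet.{u} → ZFSet.{u} → ZFSet.{u} → Prop)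
    [h : FDef (fun _ : Unit => A) fun U v => P U (v 0) (v 1) (v 2)]
    {a b c : ZFSet.{u}} (ha : a ∈ V_ μ) (hb : b ∈ V_ μ) (hc : c ∈ V_ μ) :
    P (V_ μ) a b c ↔ P (V_ θ) (J a) (J b) (J c) :=
  hJ.transfer₄ (fun U a b c _ => P U a b c) ha hb hc hc

theorem transfer₂ (P : Set ZFSet.{u} → ZFSet.{u} → ZFSet.{u} → Prop)
    [h : FDef (fun _ : Unit => A) fun U v => P U (v 0) (v 1)]
    {a b : ZFSet.{u}} (ha : a ∈ V_ μ) (hb : b ∈ V_ μ) :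
    P (V_ μ) a b ↔ P (V_ θ) (J a) (J b) :=
  hJ.transfer₄ (fun U a b _ _ => P U a b) ha hb hb hb

theorem transfer₁ (P : Set ZFSet.{u} → ZFSet.{u} → Prop)
    [h : FDef (fun _ : Unit => A) fun U v => P U (v 0)] {a : ZFSet.{u}} (ha : a ∈ V_ μ) :
    P (V_ μ) a ↔ P (V_ θ) (J a) :=
  hJ.transfer₄ (fun U a _ _ _ => P U a) ha ha ha ha

theorem mem_iff {x y : ZFSet.{u}} (hx : x ∈ V_ μ) (hy : y ∈ V_ μ) : x ∈ y ↔ J x ∈ J y :=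
  hJ.transfer₂ (fun _ x y => x ∈ y) hx hy

theorem subset_iff {x y : ZFSet.{u}} (hx : x ∈ V_ μ) (hy : y ∈ V_ μ) : x ⊆ y ↔ J x ⊆ J y :=
  hJ.transfer₂ (fun _ x y => x ⊆ y) hx hy

theorem isOrdinal {x : ZFSet.{u}} (hx : x ∈ V_ μ) : x.IsOrdinal ↔ (J x).IsOrdinal :=
  hJ.transfer₁ (fun _ x => x.IsOrdinal) hx

theorem isSuccLimit (hμ : IsSuccLimit μ) : IsSuccLimit θ := by
  have h0 : (∅ : ZFSet.{u}) ∈ V_ μ := by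
    rw [ZFSet.mem_vonNeumann, ZFSet.rank_empty]; exact hμ.bot_lt
  refine isSuccLimit_of_noMax ?_ ?_
  · have := hJ.maps _ h0
    rw [ZFSet.mem_vonNeumann] at this
    exact zero_le.trans_lt this
  · exact (hJ.transfer₁ (fun U _ => ∀ x ∈ U, ∃ y ∈ U, x ∈ y) h0).1 (noMax_of_isSuccLimit hμ)

/-- Being a level is preserved, and its height is pinned down because the ordinals in `V_a` are
exactly the elements of `a`. -/
theorem map_vonNeumann (hμ : IsSuccLimit μ) {a : Ordinal.{u}} (ha : a < μ) :
    J (V_ a) = V_ (J a.toZFSet).rank := by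
  have hV : V_ a ∈ V_ μ := ZFSet.vonNeumann_mem_of_lt ha
  have ho : a.toZFSet ∈ V_ μ := by rwa [ZFSet.mem_vonNeumann, Ordinal.rank_toZFSet]
  have h1 : Level (V_ μ : Set ZFSet.{u}) (V_ a) :=
    (level_iff (rankUniv_of_isSuccLimit hμ) hV).2 (by simp)
  rw [hJ.transfer₁ (fun U x => Level U x) hV,
    level_iff (rankUniv_of_isSuccLimit (hJ.isSuccLimit hμ)) (hJ.maps _ hV)] at h1
  have h2 : (∀ x ∈ V_ a, x.IsOrdinal → x ∈ a.toZFSet) ∧ ∀ x ∈ a.toZFSet, x ∈ V_ a := by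
    constructor
    · intro x hx hxo
      rw [← hxo.toZFSet_rank_eq, Ordinal.toZFSet_mem_toZFSet_iff]
      exact ZFSet.mem_vonNeumann.1 hx
    · exact fun x hx => Ordinal.toZFSet_subset_vonNeumann a hx
  rw [hJ.transfer₂ (fun _ v o => (∀ x ∈ v, x.IsOrdinal → x ∈ o) ∧ ∀ x ∈ o, x ∈ v) hV ho] at h2
  have hao := (hJ.isOrdinal ho).1 (ZFSet.isOrdinal_toZFSet a)
  generalize J (V_ a) = w at *
  generalize J a.toZFSet = o at *
  rw [h1]
  congr 1
  rw [h1] at h2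
  apply le_antisymm
  · by_contra! hlt
    have := h2.1 o.rank.toZFSet (by rwa [ZFSet.mem_vonNeumann, Ordinal.rank_toZFSet])
      (ZFSet.isOrdinal_toZFSet _)
    rw [hao.toZFSet_rank_eq] at this
    exact ZFSet.mem_irrefl _ this
  · by_contra! hlt
    have := h2.2 w.rank.toZFSet (by
      rw [← hao.toZFSet_rank_eq]; exact Ordinal.toZFSet_mem_toZFSet_iff.2 hlt)
    rw [ZFSet.mem_vonNeumann, Ordinal.rank_toZFSet] at this
    exact lt_irrefl _ this

/-- Induction on rank: `J x` is included in `J (V_ x.rank) = V_ x.rank`, so its elements have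
smaller rank and are fixed already. -/
theorem fix_of_fix_ordinals (hμ : IsSuccLimit μ) {κ : Ordinal.{u}} (hκ : κ < μ)
    (hfix : ∀ a < κ, J a.toZFSet = a.toZFSet) {x : ZFSet.{u}} (hx : x ∈ V_ κ) : J x = x := by
  suffices H : ∀ a, ∀ x : ZFSet.{u}, x.rank = a → a < κ → J x = x from
    H _ x rfl (ZFSet.mem_vonNeumann.1 hx)
  intro a
  induction a using WellFoundedLT.induction with
  | _ a ih =>
  rintro x rfl hlt
  have hV : ∀ y : ZFSet.{u}, y.rank ≤ x.rank → y ∈ V_ μ := fun y hy =>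
    ZFSet.mem_vonNeumann.2 (hy.trans_lt (hlt.trans hκ))
  have hxμ := hV x le_rfl
  have hsub : J x ⊆ V_ x.rank := by
    have := (hJ.subset_iff hxμ (hV (V_ x.rank) (by simp))).1 (ZFSet.subset_vonNeumann_self x)
    rwa [hJ.map_vonNeumann hμ (hlt.trans hκ), hfix _ hlt, Ordinal.rank_toZFSet] at this
  have hmem : ∀ y : ZFSet.{u}, y.rank < x.rank → (y ∈ J x ↔ y ∈ x) := by
    intro y hy
    rw [hJ.mem_iff (hV y hy.le) hxμ, ih _ hy y rfl (hy.trans hlt)]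
  ext y
  constructor
  · intro hy
    exact (hmem y (ZFSet.mem_vonNeumann.1 (hsub hy))).1 hy
  · intro hy
    exact (hmem y (ZFSet.rank_lt_of_mem hy)).2 hy

end ElemMap

/-! ### Sequences and sets coding satisfaction -/

/-- The natural number `n` as a set. -/
noncomputable def natSet (n : ℕ) : ZFSet.{u} := (n : Ordinal.{u}).toZFSet

/-- The set `ω` of natural numbers. -/
noncomputable def omegaSet : ZFSet.{u} := (Ordinal.omega0.{u}).toZFSet

theorem natSet_injective : Function.Injective natSet.{u} := fun a b h => by
  exact_mod_cast Ordinal.toZFSet_injective h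

theorem mem_omegaSet {x : ZFSet.{u}} : x ∈ omegaSet ↔ ∃ n, natSet n = x := by
  rw [omegaSet, Ordinal.mem_toZFSet_iff]
  constructor
  · rintro ⟨a, ha, rfl⟩
    obtain ⟨n, rfl⟩ := Ordinal.lt_omega0.1 ha
    exact ⟨n, rfl⟩
  · rintro ⟨n, rfl⟩
    exact ⟨n, Ordinal.natCast_lt_omega0 n, rfl⟩

/-- The sequence `s` as a function with domain `ω`. -/
noncomputable def seqSet (s : ℕ → ZFSet.{u}) : ZFSet.{u} :=
  ZFSet.range fun n : ℕ => ZFSet.pair (natSet n) (s n)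

theorem pair_mem_seqSet {s : ℕ → ZFSet.{u}} {n : ℕ} {x : ZFSet.{u}} :
    ZFSet.pair (natSet n) x ∈ seqSet s ↔ x = s n := by
  rw [seqSet, ZFSet.mem_range]
  constructor
  · rintro ⟨k, hk⟩
    obtain ⟨h1, rfl⟩ := ZFSet.pair_inj.1 hk
    rw [natSet_injective h1]
  · rintro rfl
    exact ⟨n, rfl⟩

theorem seqSet_mem_funs {s : ℕ → ZFSet.{u}} {m : ZFSet.{u}} (h : ∀ n, s n ∈ m) :
    seqSet s ∈ ZFSet.funs omegaSet m := by
  rw [ZFSet.mem_funs]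
  constructor
  · intro p hp
    obtain ⟨n, rfl⟩ := ZFSet.mem_range.1 hp
    exact ZFSet.pair_mem_prod.2 ⟨mem_omegaSet.2 ⟨n, rfl⟩, h n⟩
  · intro z hz
    obtain ⟨n, rfl⟩ := mem_omegaSet.1 hz
    exact ⟨s n, pair_mem_seqSet.2 rfl, fun y hy => pair_mem_seqSet.1 hy⟩

theorem exists_seqSet_of_mem_funs {t m : ZFSet.{u}} (h : t ∈ ZFSet.funs omegaSet m) :
    ∃ s : ℕ → ZFSet.{u}, (∀ n, s n ∈ m) ∧ seqSet s = t := by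
  obtain ⟨h1, h2⟩ := ZFSet.mem_funs.1 h
  choose s hs hu using fun n : ℕ => h2 (natSet n) (mem_omegaSet.2 ⟨n, rfl⟩)
  refine ⟨s, fun n => (ZFSet.pair_mem_prod.1 (h1 (hs n))).2, ?_⟩
  ext p
  rw [seqSet, ZFSet.mem_range]
  constructor
  · rintro ⟨n, rfl⟩
    exact hs n
  · intro hp
    obtain ⟨a, ha, b, _, rfl⟩ := ZFSet.mem_prod.1 (h1 hp)
    obtain ⟨n, rfl⟩ := mem_omegaSet.1 ha
    exact ⟨n, by rw [hu n b hp]⟩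

/-- The set `D` of sequences defines the satisfaction relation of `φ` in `⟨V_l, ∈, A⟩`. -/
def Codes (A : Set ZFSet.{u}) (l : Ordinal.{u}) {n k : ℕ}
    (φ : (setLang Unit).BoundedFormula (Fin n) k) (D : ZFSet.{u}) : Prop :=
  ∀ s : ℕ → VStr A l, seqSet (fun i => (s i).1) ∈ D ↔
    φ.Realize (fun i => s i) (fun i => s (n + i))

section codes
variable {A : Set ZFSet.{u}} {l : Ordinal.{u}} {n k : ℕ}

theorem seqSet_val_mem_funs (s : ℕ → VStr A l) :
    seqSet (fun i => (s i).1) ∈ ZFSet.funs omegaSet (V_ l) :=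
  seqSet_mem_funs fun i => (s i).2

theorem Codes.falsum {U : Set ZFSet.{u}} {T c d e : ZFSet.{u}}
    (h : Prim.bot.Holds A U T (ZFSet.funs omegaSet (V_ l)) c d e) :
    Codes A l (BoundedFormula.falsum : (setLang Unit).BoundedFormula (Fin n) k) T :=
  fun s => iff_of_false (h _ (seqSet_val_mem_funs s)) id

theorem Codes.imp {U : Set ZFSet.{u}} {T D E e : ZFSet.{u}}
    {φ ψ : (setLang Unit).BoundedFormula (Fin n) k} (hφ : Codes A l φ D) (hψ : Codes A l ψ E)
    (h : Prim.imp.Holds A U T (ZFSet.funs omegaSet (V_ l)) D E e) : Codes A l (φ.imp ψ) T := by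
  intro s
  rw [h _ (seqSet_val_mem_funs s), hφ s, hψ s]
  exact BoundedFormula.realize_imp.symm

theorem Codes.all {U : Set ZFSet.{u}} (hU : RankUniv U) (hl : V_ l ∈ U) {T D : ZFSet.{u}}
    {φ : (setLang Unit).BoundedFormula (Fin n) (k + 1)} (hφ : Codes A l φ D)
    (h : Prim.all.Holds A U T (ZFSet.funs omegaSet (V_ l)) D (natSet (n + k)) omegaSet) :
    Codes A l φ.all T := by
  intro s
  rw [h _ (seqSet_val_mem_funs s)]
  refine Iff.trans ?_ BoundedFormula.realize_all.symm
  constructor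
  · intro H x
    -- Position `n + k` holds the variable that the quantifier binds: free variables occupy `0, …, n
    -- - 1`, earlier bound ones `n, …, n + k - 1`.
    let t : ℕ → VStr A l := Function.update s (n + k) x
    have hst : ∀ i, i ≠ n + k → t i = s i := fun i hi => Function.update_of_ne hi _ _
    have h1 := H _ (seqSet_val_mem_funs t) (by
      intro i hi hne x _ hx
      obtain ⟨i, rfl⟩ := mem_omegaSet.1 hi
      rw [pair_mem_seqSet] at hx ⊢
      rw [hx, hst i fun h => hne (by rw [h])])
    rw [hφ t] at h1
    convert h1 using 1
    · funext i
      exact (hst i (by omega)).symm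
    · funext i
      refine Fin.lastCases ?_ (fun i => ?_) i
      · simp [t]
      · simp only [Fin.snoc_castSucc, Fin.val_castSucc]
        exact (hst _ (by omega)).symm
  · intro H t' ht' hag
    obtain ⟨t₀, ht₀, rfl⟩ := exists_seqSet_of_mem_funs ht'
    let t : ℕ → VStr A l := fun i => ⟨t₀ i, ht₀ i⟩
    have hst : ∀ i, i ≠ n + k → t i = s i := by
      intro i hi
      have := hag (natSet i) (mem_omegaSet.2 ⟨i, rfl⟩) (fun h => hi (natSet_injective h)) (s i).1
        (hU.trans hl (s i).2) (pair_mem_seqSet.2 rfl)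
      exact Subtype.ext (pair_mem_seqSet.1 this).symm
    refine (hφ t).2 ?_
    convert H (t (n + k)) using 1
    · funext i
      exact hst i (by omega)
    · funext i
      refine Fin.lastCases ?_ (fun i => ?_) i
      · simp
      · simp only [Fin.snoc_castSucc, Fin.val_castSucc]
        exact hst _ (by omega)

/-- The position in a sequence of the value of a variable. -/
def varIndex (n k : ℕ) : Fin n ⊕ Fin k → ℕ := Sum.elim (fun i => i) fun i => n + i

theorem elim_eq_varIndex (s : ℕ → VStr A l) (x : Fin n ⊕ Fin k) :
    Sum.elim (fun i : Fin n => s i) (fun i : Fin k => s (n + i)) x = s (varIndex n k x) := by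
  cases x <;> rfl

theorem Codes.equal {U : Set ZFSet.{u}} (hU : RankUniv U) (hl : V_ l ∈ U) {T e : ZFSet.{u}}
    {x y : Fin n ⊕ Fin k}
    (h : Prim.atomEq.Holds A U T (ZFSet.funs omegaSet (V_ l)) (natSet (varIndex n k x))
      (natSet (varIndex n k y)) e) :
    Codes A l (BoundedFormula.equal (Term.var x) (Term.var y) :
      (setLang Unit).BoundedFormula (Fin n) k) T := by
  intro s
  rw [h _ (seqSet_val_mem_funs s)]
  simp only [pair_mem_seqSet, BoundedFormula.Realize, Term.realize_var, elim_eq_varIndex]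
  constructor
  · rintro ⟨z, _, h1, h2⟩
    exact Subtype.ext (h1.symm.trans h2)
  · intro h
    exact ⟨_, hU.trans hl (s _).2, rfl, by rw [h]⟩

theorem Codes.mem {U : Set ZFSet.{u}} (hU : RankUniv U) (hl : V_ l ∈ U) {T e : ZFSet.{u}}
    {ts : Fin 2 → (setLang Unit).Term (Fin n ⊕ Fin k)} {x y : Fin n ⊕ Fin k}
    (hx : ts 0 = Term.var x) (hy : ts 1 = Term.var y)
    (h : Prim.atomMem.Holds A U T (ZFSet.funs omegaSet (V_ l)) (natSet (varIndex n k x))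
      (natSet (varIndex n k y)) e) :
    Codes A l (BoundedFormula.rel (L := setLang Unit) SetRel.mem ts) T := by
  intro s
  rw [h _ (seqSet_val_mem_funs s)]
  have : (BoundedFormula.rel (L := setLang Unit) SetRel.mem ts).Realize
      (fun i : Fin n => s i) (fun i : Fin k => s (n + i)) ↔
      (s (varIndex n k x)).1 ∈ (s (varIndex n k y)).1 := by
    rw [← elim_eq_varIndex s x, ← elim_eq_varIndex s y]
    change ((ts 0).realize _ : VStr A l).1 ∈ ((ts 1).realize _ : VStr A l).1 ↔ _
    rw [hx, hy]
    rfl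
  rw [this]
  simp only [pair_mem_seqSet]
  constructor
  · rintro ⟨z, _, w, _, rfl, rfl, h⟩
    exact h
  · intro h
    exact ⟨_, hU.trans hl (s _).2, _, hU.trans hl (s _).2, rfl, rfl, h⟩

theorem Codes.cls {U : Set ZFSet.{u}} (hU : RankUniv U) (hl : V_ l ∈ U) {T d e : ZFSet.{u}}
    {ts : Fin 1 → (setLang Unit).Term (Fin n ⊕ Fin k)} {c : Unit} {x : Fin n ⊕ Fin k}
    (hx : ts 0 = Term.var x)
    (h : Prim.atomCls.Holds A U T (ZFSet.funs omegaSet (V_ l)) (natSet (varIndex n k x)) d e) :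
    Codes A l (BoundedFormula.rel (L := setLang Unit) (SetRel.cls c) ts) T := by
  intro s
  rw [h _ (seqSet_val_mem_funs s)]
  have : (BoundedFormula.rel (L := setLang Unit) (SetRel.cls c) ts).Realize
      (fun i : Fin n => s i) (fun i : Fin k => s (n + i)) ↔
      (s (varIndex n k x)).1 ∈ A := by
    rw [← elim_eq_varIndex s x]
    change ((ts 0).realize _ : VStr A l).1 ∈ A ↔ _
    rw [hx]
    rfl
  rw [this]
  simp only [pair_mem_seqSet]
  constructor
  · rintro ⟨z, _, rfl, h⟩
    exact h
  · intro h
    exact ⟨_, hU.trans hl (s _).2, rfl, h⟩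

end codes

/-! ### From preserved primitive relations to elementarity -/

/-- `J` maps `V_ρ` to `V_θ` and preserves the relations named by `Prim`. -/
structure PrimMap (A : Set ZFSet.{u}) (ρ θ : Ordinal.{u}) (J : ZFSet.{u} → ZFSet.{u}) : Prop where
  maps : ∀ x ∈ V_ ρ, J x ∈ V_ θ
  pres : ∀ (t : Prim), ∀ a ∈ V_ ρ, ∀ b ∈ V_ ρ, ∀ c ∈ V_ ρ, ∀ d ∈ V_ ρ, ∀ e ∈ V_ ρ,
    t.Holds A (V_ ρ) a b c d e → t.Holds A (V_ θ) (J a) (J b) (J c) (J d) (J e)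

theorem exists_eq_var {α : Type*} (t : (setLang Unit).Term α) : ∃ x, t = Term.var x := by
  cases t with
  | var x => exact ⟨x, rfl⟩
  | func f _ => exact Empty.elim f

namespace PrimMap
variable {A : Set ZFSet.{u}} {ρ θ : Ordinal.{u}} {J : ZFSet.{u} → ZFSet.{u}}
  (hJ : PrimMap A ρ θ J)
include hJ

/-- Preservation goes one way only; the converse is the reason for having `notMem` among the
primitives. -/
theorem mem_iff {x y : ZFSet.{u}} (hx : x ∈ V_ ρ) (hy : y ∈ V_ ρ) : x ∈ y ↔ J x ∈ J y :=
  ⟨fun h => hJ.pres .mem x hx y hy x hx x hx x hx h, fun h => by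
    by_contra hn
    exact hJ.pres .notMem x hx y hy x hx x hx x hx hn h⟩

variable (hρ : IsSuccLimit ρ) (hθ : IsSuccLimit θ) (hω : omegaSet ∈ V_ ρ)
  (hJω : J omegaSet = omegaSet) (hJn : ∀ n, J (natSet n) = natSet n)
  {l l' : Ordinal.{u}} (hl : l < ρ) (hl' : J (V_ l) = V_ l')
include hρ hθ hω hJω hl hl'

theorem map_funs : J (ZFSet.funs omegaSet (V_ l)) = ZFSet.funs omegaSet (V_ l') := by
  have hU := rankUniv_of_isSuccLimit hρ
  have hU' := rankUniv_of_isSuccLimit hθ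
  have hV : V_ l ∈ V_ ρ := ZFSet.vonNeumann_mem_of_lt hl
  have hV' : V_ l' ∈ V_ θ := hl' ▸ hJ.maps _ hV
  have hω' : omegaSet ∈ V_ θ := hJω ▸ hJ.maps _ hω
  have hS := hU.funs hω hV
  have h := hJ.pres .funs _ hS _ hω _ hV _ hω _ hω fun s _ => ZFSet.mem_funs
  rw [hl', hJω] at h
  ext s
  constructor
  · intro hs
    exact ZFSet.mem_funs.2 ((h s (hU'.trans (hJ.maps _ hS) hs)).1 hs)
  · intro hs
    exact (h s (hU'.trans (hU'.funs hω' hV') hs)).2 (ZFSet.mem_funs.1 hs)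

include hJn

theorem map_seqSet {s : ℕ → ZFSet.{u}} (hs : ∀ n, s n ∈ V_ l) :
    J (seqSet s) = seqSet fun n => J (s n) := by
  have hU := rankUniv_of_isSuccLimit hρ
  have hV : V_ l ∈ V_ ρ := ZFSet.vonNeumann_mem_of_lt hl
  have hS := hU.funs hω hV
  have h := seqSet_mem_funs hs
  have hsρ := hU.trans hS h
  have h' := (hJ.mem_iff hsρ hS).1 h
  rw [hJ.map_funs hρ hθ hω hJω hl hl'] at h'
  obtain ⟨t, _, ht⟩ := exists_seqSet_of_mem_funs h'
  rw [← ht]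
  congr 1
  funext n
  have hsn := hU.trans hV (hs n)
  have hn : natSet n ∈ V_ ρ := hU.trans hω (mem_omegaSet.2 ⟨n, rfl⟩)
  have hp : ZFSet.pair (natSet n) (s n) ∈ seqSet s := pair_mem_seqSet.2 rfl
  have hpρ := hU.trans hsρ hp
  have h1 := (hJ.mem_iff hpρ hsρ).1 hp
  have h2 : J (ZFSet.pair (natSet n) (s n)) = ZFSet.pair (J (natSet n)) (J (s n)) :=
    hJ.pres .pair _ hpρ _ hn _ hsn _ hn _ hn rfl
  rw [h2, hJn, ← ht] at h1
  exact (pair_mem_seqSet.1 h1).symm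

/-- Tarski's recursion, carried out on actual formulas. Each connective has a primitive relation
that ties its set of satisfying sequences to those of the subformulas, and `J` preserves that
relation. The sets lie in `V_ρ` because `ρ` is a limit above `l`. -/
theorem exists_codes {n k : ℕ} (φ : (setLang Unit).BoundedFormula (Fin n) k) :
    ∃ D ∈ V_ ρ, Codes A l φ D ∧ Codes A l' φ (J D) := by
  have hU := rankUniv_of_isSuccLimit hρ
  have hU' := rankUniv_of_isSuccLimit hθ
  have hV : V_ l ∈ V_ ρ := ZFSet.vonNeumann_mem_of_lt hl
  have hV' : V_ l' ∈ V_ θ := hl' ▸ hJ.maps _ hV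
  have hS := hU.funs hω hV
  have hJS := hJ.map_funs hρ hθ hω hJω hl hl'
  have hn : ∀ i, natSet i ∈ V_ ρ := fun i => hU.trans hω (mem_omegaSet.2 ⟨i, rfl⟩)
  have hsep : ∀ p, (ZFSet.funs omegaSet (V_ l)).sep p ∈ V_ ρ := fun p =>
    hU.subset hS ZFSet.sep_subset
  have hmem : ∀ p, ∀ s ∈ ZFSet.funs omegaSet (V_ l),
      s ∈ (ZFSet.funs omegaSet (V_ l)).sep p ↔ p s := fun p s hs => by
    rw [ZFSet.mem_sep, and_iff_right hs]
  induction φ with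
  | falsum =>
    have h : Prim.bot.Holds A (V_ ρ) ∅ (ZFSet.funs omegaSet (V_ l)) omegaSet omegaSet omegaSet :=
      fun s _ => ZFSet.notMem_empty s
    have h0 : (∅ : ZFSet.{u}) ∈ V_ ρ := hU.subset hω (ZFSet.empty_subset _)
    have h' := hJ.pres _ _ h0 _ hS _ hω _ hω _ hω h
    rw [hJS] at h'
    exact ⟨_, h0, .falsum h, .falsum h'⟩
  | @equal k t₁ t₂ =>
    obtain ⟨x, rfl⟩ := exists_eq_var t₁
    obtain ⟨y, rfl⟩ := exists_eq_var t₂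
    have h : Prim.atomEq.Holds A (V_ ρ) _ (ZFSet.funs omegaSet (V_ l)) (natSet (varIndex n k x))
      (natSet (varIndex n k y)) omegaSet := hmem _
    have h' := hJ.pres _ _ (hsep _) _ hS _ (hn _) _ (hn _) _ hω h
    rw [hJS, hJn, hJn] at h'
    exact ⟨_, hsep _, .equal hU hV h, .equal hU' hV' h'⟩
  | @rel k r R ts =>
    cases R with
    | mem =>
      obtain ⟨x, hx⟩ := exists_eq_var (ts 0)
      obtain ⟨y, hy⟩ := exists_eq_var (ts 1)
      have h : Prim.atomMem.Holds A (V_ ρ) _ (ZFSet.funs omegaSet (V_ l))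
        (natSet (varIndex n k x)) (natSet (varIndex n k y)) omegaSet := hmem _
      have h' := hJ.pres _ _ (hsep _) _ hS _ (hn _) _ (hn _) _ hω h
      rw [hJS, hJn, hJn] at h'
      exact ⟨_, hsep _, .mem hU hV hx hy h, .mem hU' hV' hx hy h'⟩
    | cls c =>
      obtain ⟨x, hx⟩ := exists_eq_var (ts 0)
      have h : Prim.atomCls.Holds A (V_ ρ) _ (ZFSet.funs omegaSet (V_ l))
        (natSet (varIndex n k x)) omegaSet omegaSet := hmem _
      have h' := hJ.pres _ _ (hsep _) _ hS _ (hn _) _ hω _ hω h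
      rw [hJS, hJn] at h'
      exact ⟨_, hsep _, .cls hU hV hx h, .cls hU' hV' hx h'⟩
  | imp φ ψ ihφ ihψ =>
    obtain ⟨D, hD, h1, h1'⟩ := ihφ
    obtain ⟨E, hE, h2, h2'⟩ := ihψ
    have h : Prim.imp.Holds A (V_ ρ) _ (ZFSet.funs omegaSet (V_ l)) D E omegaSet := hmem _
    have h' := hJ.pres _ _ (hsep _) _ hS _ hD _ hE _ hω h
    rw [hJS] at h'
    exact ⟨_, hsep _, .imp h1 h2 h, .imp h1' h2' h'⟩
  | @all k φ ih =>
    obtain ⟨D, hD, h1, h1'⟩ := ih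
    have h : Prim.all.Holds A (V_ ρ) _ (ZFSet.funs omegaSet (V_ l)) D (natSet (n + k)) omegaSet :=
      hmem _
    have h' := hJ.pres _ _ (hsep _) _ hS _ hD _ (hn _) _ hω h
    rw [hJS, hJn, hJω] at h'
    exact ⟨_, hsep _, .all hU hV h1 h, .all hU' hV' h1' h'⟩

theorem exists_elementaryEmbedding (hl0 : 0 < l) :
    ∃ j : (setLang Unit).ElementaryEmbedding (VStr A l) (VStr A l'), ∀ x, (j x).1 = J x.1 := by
  have hU := rankUniv_of_isSuccLimit hρ
  have hV : V_ l ∈ V_ ρ := ZFSet.vonNeumann_mem_of_lt hl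
  have hmaps : ∀ x : VStr A l, J x.1 ∈ V_ l' := fun x =>
    hl' ▸ (hJ.mem_iff (hU.trans hV x.2) hV).1 x.2
  let f : VStr A l → VStr A l' := fun x => ⟨J x.1, hmaps x⟩
  refine ⟨⟨f, fun n φ x => ?_⟩, fun x => rfl⟩
  obtain ⟨D, hD, h1, h2⟩ := hJ.exists_codes hρ hθ hω hJω hJn hl hl' φ
  -- The finite assignment is padded with `∅`, an element of `V_l` since `0 < l`.
  let s : ℕ → VStr A l := fun i => if h : i < n then x ⟨i, h⟩ else
    ⟨∅, by rw [ZFSet.mem_vonNeumann, ZFSet.rank_empty]; exact hl0⟩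
  have hs : (fun i : Fin n => s i) = x := by
    funext i; simp [s]
  have e1 := h1 s
  have e2 := h2 fun i => f (s i)
  have hsl : seqSet (fun i => (s i).1) ∈ V_ ρ :=
    hU.trans (hU.funs hω hV) (seqSet_val_mem_funs s)
  have e3 := hJ.mem_iff hsl hD
  rw [hJ.map_seqSet hρ hθ hω hJω hJn hl hl' fun i => (s i).2] at e3
  rw [hs] at e1
  have hfs : (fun i : Fin n => f (s i)) = f ∘ x := by
    rw [← hs]; rfl
  rw [hfs] at e2
  rw [Formula.Realize, Formula.Realize]
  have e4 := e2.symm.trans (e3.symm.trans e1)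
  convert e4 using 1 <;> exact iff_of_eq (congrArg _ (Subsingleton.elim _ _))

end PrimMap

/-- The embeddings extracted from a map that anticipates `a`. -/
theorem Anticipates.exists_isExtEmb {A : Set ZFSet.{u}} {κ l ρ : Ordinal.{u}} {f a Y j : ZFSet.{u}}
    (hκ : Ordinal.omega0 < κ) (hl : κ < l) (hlρ : l < ρ) (hρ : IsSuccLimit ρ)
    (hY : ∃ θ, Y = V_ θ) (hf : f ∈ V_ l)
    (h : Anticipates A κ.toZFSet f (V_ ρ) a Y j) :
    ∃ (θ : Ordinal.{u}) (i : (setLang Unit).ElementaryEmbedding (VStr A l) (VStr A θ)),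
      IsExtEmb A κ l θ i ∧ ∃ x : VStr A l, x.1 = f ∧ ZFSet.pair κ.toZFSet a ∈ (i x).1 := by
  obtain ⟨θ, rfl⟩ := hY
  have hU := rankUniv_of_isSuccLimit hρ
  have hV : V_ l ∈ V_ ρ := ZFSet.vonNeumann_mem_of_lt hlρ
  have hord : ∀ b < ρ, b.toZFSet ∈ V_ ρ := fun b hb => by
    rwa [ZFSet.mem_vonNeumann, Ordinal.rank_toZFSet]
  have htotal : ∀ x, ∃ y, x ∈ V_ ρ → y ∈ V_ θ ∧ ZFSet.pair x y ∈ j := fun x => by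
    by_cases hx : x ∈ V_ ρ
    · obtain ⟨y, hy⟩ := h.total x hx
      exact ⟨y, fun _ => hy⟩
    · exact ⟨∅, fun h => absurd h hx⟩
  choose J hJ using htotal
  have hP : PrimMap A ρ θ J := ⟨fun x hx => (hJ x hx).1, fun t a ha b hb c hc d hd e he ht =>
    h.preserved t a ha b hb c hc d hd e he ht _ (hJ a ha).1 _ (hJ b hb).1 _ (hJ c hc).1
      _ (hJ d hd).1 _ (hJ e he).1 (hJ a ha).2 (hJ b hb).2 (hJ c hc).2 (hJ d hd).2 (hJ e he).2⟩
  -- Preservation of equality makes the relation `j` single-valued on `V_ρ`.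
  have huniq : ∀ x ∈ V_ ρ, ∀ y ∈ V_ θ, ZFSet.pair x y ∈ j → J x = y := fun x hx y hy hxy =>
    h.preserved .eq x hx x hx x hx x hx x hx rfl _ (hJ x hx).1 _ hy _ hy _ hy _ hy
      (hJ x hx).2 hxy hxy hxy hxy
  have hκρ : κ < ρ := hl.trans hlρ
  obtain ⟨κ', hκ', hκj, hκo⟩ := h.moves
  have hJκ := huniq _ (hord κ hκρ) _ hκ' hκj
  obtain ⟨f', hf', hfj, hfa⟩ := h.value
  have hJf := huniq _ (hU.trans hV hf) _ hf' hfj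
  have hθ : IsSuccLimit θ := isSuccLimit_of_noMax (by
    rw [ZFSet.mem_vonNeumann] at hκ'; exact zero_le.trans_lt hκ') h.noMax
  have hfix : ∀ b < κ, J b.toZFSet = b.toZFSet := fun b hb => by
    have hbρ := hord b (hb.trans hκρ)
    have hbκ := h.fix _ (Ordinal.toZFSet_mem_toZFSet_iff.2 hb)
    have h1 := (hP.mem_iff hbρ (hord κ hκρ)).1 (Ordinal.toZFSet_mem_toZFSet_iff.2 hb)
    -- Single-valuedness applies only to values in `V_θ`, so `b` must first be located there,
    -- through `κ'`.
    have hbκ' : b.toZFSet ∈ κ' := hκo _ hbρ (ZFSet.isOrdinal_toZFSet b)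
    exact huniq _ hbρ _ ((rankUniv_of_isSuccLimit hθ).trans hκ' hbκ') hbκ
  obtain ⟨l', hl'⟩ : ∃ l', J (V_ l) = V_ l' :=
    ⟨_, (level_iff (rankUniv_of_isSuccLimit hθ) (hP.maps _ hV)).1 (hP.pres .level _ hV _ hV _ hV
      _ hV _ hV ((level_iff hU hV).2 (by simp)))⟩
  obtain ⟨i, hi⟩ := hP.exists_elementaryEmbedding hρ hθ (hord _ (hκ.trans hκρ)) (hfix _ hκ)
    (fun n => hfix _ ((Ordinal.natCast_lt_omega0 n).trans hκ)) hlρ hl' (zero_le.trans_lt hl)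
  refine ⟨l', i, ⟨hl, fun b hb => ?_, ?_, ?_⟩, ⟨f, hf⟩, rfl, ?_⟩
  · rw [hi]; exact hfix b hb
  · rw [hi]
    change J κ.toZFSet ≠ _
    rw [hJκ]
    intro heq
    exact ZFSet.mem_irrefl _ (heq ▸ hκo _ (hord κ hκρ) (ZFSet.isOrdinal_toZFSet κ))
  · rw [hi]
    change _ ∈ J κ.toZFSet
    rw [hJκ]
    exact hκo _ (hord l hlρ) (ZFSet.isOrdinal_toZFSet l)
  · exact ((hi (⟨f, hf⟩ : VStr A l)).trans hJf).symm ▸ hfa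

/-! ### Elementary maps with a critical point -/

theorem toZFSet_mem_vonNeumann {a b : Ordinal.{u}} : a.toZFSet ∈ V_ b ↔ a < b := by
  rw [ZFSet.mem_vonNeumann, Ordinal.rank_toZFSet]

/-- An elementary map of `V_μ` with critical point `κ`, of degree the limit ordinal `μ`. -/
structure CritMap (A : Set ZFSet.{u}) (κ μ θ : Ordinal.{u}) (J : ZFSet.{u} → ZFSet.{u}) : Prop
    extends ElemMap A μ θ J where
  isLimit : IsSuccLimit μ
  lt : κ < μ
  fix_ordinal : ∀ b < κ, J b.toZFSet = b.toZFSet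
  degree : μ.toZFSet ∈ J κ.toZFSet

theorem IsExtendible.exists_critMap {A : Set ZFSet.{u}} {κ μ : Ordinal.{u}}
    (h : IsExtendible A κ) (hμ : IsSuccLimit μ) (hκ : κ < μ) : ∃ θ J, CritMap A κ μ θ J := by
  obtain ⟨θ, j, hj⟩ := h.2 μ hκ
  have e : ∀ b (hb : b < μ), extendMap j b.toZFSet = (j (VStr.ord A hb)).1 := fun b hb =>
    extendMap_of_mem j (toZFSet_mem_vonNeumann.2 hb)
  exact ⟨θ, extendMap j, elemMap_extendMap j, hμ, hκ,
    fun b hb => (e b (hb.trans hκ)).trans (hj.fix_below b hb), e κ hκ ▸ hj.degree_lt⟩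

namespace CritMap
variable {A : Set ZFSet.{u}} {κ μ θ : Ordinal.{u}} {J : ZFSet.{u} → ZFSet.{u}}
  (hJ : CritMap A κ μ θ J)
include hJ

theorem mem_of_lt {b : Ordinal.{u}} (hb : b < μ) : b.toZFSet ∈ J κ.toZFSet := by
  have h := (hJ.isOrdinal (toZFSet_mem_vonNeumann.2 hJ.lt)).1 (ZFSet.isOrdinal_toZFSet κ)
  exact h.subset_of_mem hJ.degree (Ordinal.toZFSet_mem_toZFSet_iff.2 hb)

theorem fix {x : ZFSet.{u}} (hx : x ∈ V_ κ) : J x = x :=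
  hJ.fix_of_fix_ordinals hJ.isLimit hJ.lt hJ.fix_ordinal hx

/-- The image of `V_κ` is a level above `V_μ`. -/
theorem exists_map_vonNeumann : ∃ κ', J (V_ κ) = V_ κ' ∧ μ < κ' ∧ κ' < θ := by
  refine ⟨_, hJ.map_vonNeumann hJ.isLimit hJ.lt, ?_, ?_⟩
  · have := ZFSet.rank_lt_of_mem hJ.degree
    rwa [Ordinal.rank_toZFSet] at this
  · exact ZFSet.mem_vonNeumann.1 (hJ.maps _ (toZFSet_mem_vonNeumann.2 hJ.lt))

/-- If `κ` were `b + 1`, then `b`, being fixed, would still be the largest element of `J κ`, which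
contains `μ > b`. If `κ` were `0`, its image would be empty. -/
theorem isSuccLimit_crit : IsSuccLimit κ := by
  have hκμ := toZFSet_mem_vonNeumann.2 hJ.lt
  refine ⟨?_, isSuccPrelimit_iff_succ_ne.2 fun b hb => ?_⟩
  · rw [isMin_iff_eq_bot]
    rintro rfl
    have h : J (Ordinal.toZFSet ⊥) = ∅ :=
      (hJ.transfer₁ (fun _ x => x = ∅) hκμ).1 Ordinal.toZFSet_zero
    have := hJ.degree
    rw [h] at this
    exact ZFSet.notMem_empty _ this
  · have hbκ : b < κ := hb ▸ lt_succ b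
    have h1 : ∀ z ∈ κ.toZFSet, z ∈ b.toZFSet ∨ z = b.toZFSet := by
      intro z hz
      rw [← hb, succ_eq_add_one, Ordinal.toZFSet_add_one, ZFSet.mem_insert_iff] at hz
      exact hz.symm
    rw [hJ.transfer₂ (fun _ x y => ∀ z ∈ x, z ∈ y ∨ z = y) hκμ
      (toZFSet_mem_vonNeumann.2 (hbκ.trans hJ.lt)), hJ.fix_ordinal b hbκ] at h1
    rcases h1 _ hJ.degree with h | h
    · exact (Ordinal.toZFSet_mem_toZFSet_iff.1 h).not_gt (hbκ.trans hJ.lt)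
    · exact (hbκ.trans hJ.lt).ne' (Ordinal.toZFSet_injective h)

theorem isSuccLimit_of_map_eq {κ' : Ordinal.{u}} (h : J (V_ κ) = V_ κ') : IsSuccLimit κ' := by
  refine isSuccLimit_of_noMax ?_ ?_
  · have := hJ.map_vonNeumann hJ.isLimit hJ.lt
    rw [h, ZFSet.vonNeumann_inj] at this
    rw [this]
    exact zero_le.trans_lt (ZFSet.rank_lt_of_mem hJ.degree)
  · rw [← h]
    exact (hJ.transfer₁ (fun _ X => NoMax X) (ZFSet.vonNeumann_mem_of_lt hJ.lt)).1
      (noMax_of_isSuccLimit hJ.isSuccLimit_crit)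

/-- Every element of `ω` is empty or has a largest element. The limit `μ` would be an element of `J
ω` violating this. -/
theorem omega0_lt_crit : Ordinal.omega0 < κ := by
  refine lt_of_le_of_ne (Ordinal.omega0_le_of_isSuccLimit hJ.isSuccLimit_crit) ?_
  rintro rfl
  have hκμ := toZFSet_mem_vonNeumann.2 hJ.lt
  have h1 : ∀ x ∈ Ordinal.omega0.{u}.toZFSet, x = ∅ ∨ ∃ y ∈ x, ∀ z ∈ x, z ∈ y ∨ z = y := by
    intro x hx
    obtain ⟨n, rfl⟩ := mem_omegaSet.1 hx
    cases n with
    | zero => left; simp [natSet]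
    | succ n =>
      right
      have : natSet (n + 1) = insert (natSet n) (natSet n) := by
        rw [natSet, Nat.cast_succ, Ordinal.toZFSet_add_one, natSet]
      rw [this]
      exact ⟨natSet n, by simp, fun z hz => (ZFSet.mem_insert_iff.1 hz).symm⟩
  rw [hJ.transfer₁ (fun _ w => ∀ x ∈ w, x = ∅ ∨ ∃ y ∈ x, ∀ z ∈ x, z ∈ y ∨ z = y) hκμ] at h1
  rcases h1 _ hJ.degree with h | ⟨y, hy, h⟩
  · have := Ordinal.toZFSet_mem_toZFSet_iff.2 hJ.lt
    rw [h] at this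
    exact ZFSet.notMem_empty _ this
  · obtain ⟨b, hb, rfl⟩ := Ordinal.mem_toZFSet_iff.1 hy
    have hb' : b + 1 < μ := hJ.isLimit.add_one_lt hb
    rcases h _ (Ordinal.toZFSet_mem_toZFSet_iff.2 hb') with h | h
    · exact (Ordinal.toZFSet_mem_toZFSet_iff.1 h).not_gt (lt_add_one b)
    · exact (lt_add_one b).ne' (Ordinal.toZFSet_injective h)

/-- The restriction of an elementary map to a smaller limit level is a set that anticipates. -/
theorem exists_anticipates {ρ : Ordinal.{u}} (hρ : IsSuccLimit ρ) (hρμ : ρ < μ) (hκρ : κ < ρ)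
    {f a : ZFSet.{u}} (hf : f ∈ V_ ρ) (ha : ZFSet.pair κ.toZFSet a ∈ J f) :
    ∃ j ∈ V_ θ, Anticipates A κ.toZFSet f (V_ ρ) a (J (V_ ρ)) j := by
  have hU := rankUniv_of_isSuccLimit hJ.isLimit
  have hU' := rankUniv_of_isSuccLimit (hJ.isSuccLimit hJ.isLimit)
  have hV : V_ ρ ∈ V_ μ := ZFSet.vonNeumann_mem_of_lt hρμ
  have hμ : ∀ x ∈ V_ ρ, x ∈ V_ μ := fun x hx => hU.trans hV hx
  have hmaps : ∀ x ∈ V_ ρ, J x ∈ J (V_ ρ) := fun x hx => (hJ.mem_iff (hμ x hx) hV).1 hx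
  have hVθ := hJ.maps _ hV
  -- From `V_κ ⊆ V_ρ` follows `V_κ' ⊆ J (V_ ρ)`, where `κ' > μ > ρ`.
  have hsub : V_ ρ ⊆ J (V_ ρ) := by
    rw [hJ.map_vonNeumann hJ.isLimit hρμ, ZFSet.vonNeumann_subset_vonNeumann_iff]
    by_contra! hlt
    obtain ⟨κ', hκ', h1, h2⟩ := hJ.exists_map_vonNeumann
    have := (hJ.subset_iff (ZFSet.vonNeumann_mem_of_lt hJ.lt) hV).1
      (ZFSet.vonNeumann_subset_of_le hκρ.le)
    rw [hκ', hJ.map_vonNeumann hJ.isLimit hρμ, ZFSet.vonNeumann_subset_vonNeumann_iff] at this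
    exact (hlt.trans hρμ).not_ge (h1.le.trans this)
  have hVθ' : V_ ρ ∈ V_ θ := hU'.subset hVθ hsub
  let j := (ZFSet.prod (V_ ρ) (J (V_ ρ))).sep fun p => ∃ x, p = ZFSet.pair x (J x)
  have hj : ∀ x y, ZFSet.pair x y ∈ j ↔ x ∈ V_ ρ ∧ y = J x := by
    intro x y
    rw [ZFSet.mem_sep, ZFSet.pair_mem_prod]
    constructor
    · rintro ⟨⟨hx, _⟩, z, hz⟩
      obtain ⟨rfl, rfl⟩ := ZFSet.pair_inj.1 hz
      exact ⟨hx, rfl⟩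
    · rintro ⟨hx, rfl⟩
      exact ⟨⟨hx, hmaps x hx⟩, x, rfl⟩
  have hκV := toZFSet_mem_vonNeumann.2 hκρ
  refine ⟨j, hU'.subset (hU'.prod hVθ' hVθ) ZFSet.sep_subset, ?_, ?_, ?_, ?_, ?_, ?_⟩
  · exact (hJ.transfer₁ (fun _ X => NoMax X) hV).1 (noMax_of_isSuccLimit hρ)
  · exact fun x hx => ⟨J x, hmaps x hx, (hj _ _).2 ⟨hx, rfl⟩⟩
  · intro t a ha b hb c hc d hd e he ht a' _ b' _ c' _ d' _ e' _ haj hbj hcj hdj hej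
    obtain ⟨-, rfl⟩ := (hj _ _).1 haj
    obtain ⟨-, rfl⟩ := (hj _ _).1 hbj
    obtain ⟨-, rfl⟩ := (hj _ _).1 hcj
    obtain ⟨-, rfl⟩ := (hj _ _).1 hdj
    obtain ⟨-, rfl⟩ := (hj _ _).1 hej
    -- The relation is evaluated in the parameter `V_ρ`, so elementarity moves the evaluation to `J
    -- (V_ ρ)`.
    exact (hJ.transfer₆ (fun _ X a b c d e => t.Holds A X a b c d e) hV (hμ a ha) (hμ b hb)
      (hμ c hc) (hμ d hd) (hμ e he)).1 ht
  · intro x hx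
    obtain ⟨b, hb, rfl⟩ := Ordinal.mem_toZFSet_iff.1 hx
    exact (hj _ _).2 ⟨toZFSet_mem_vonNeumann.2 (hb.trans hκρ), (hJ.fix_ordinal b hb).symm⟩
  · refine ⟨_, hmaps _ hκV, (hj _ _).2 ⟨hκV, rfl⟩, fun x hx hxo => ?_⟩
    rw [← hxo.toZFSet_rank_eq]
    exact hJ.mem_of_lt ((ZFSet.mem_vonNeumann.1 hx).trans hρμ)
  · exact ⟨_, hmaps f hf, (hj _ _).2 ⟨hf, rfl⟩, ha⟩

end CritMap

/-! ### Reflection of success and failure -/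

theorem level_congr {U U' : Set ZFSet.{u}} (hU : RankUniv U) (hU' : RankUniv U') {x : ZFSet.{u}}
    (hx : x ∈ U) (hx' : x ∈ U') : Level U x ↔ Level U' x := by
  rw [level_iff hU hx, level_iff hU' hx']

/-- `Anticipates` does not mention the universe, so only the absoluteness of levels is at stake. -/
theorem Success.mono {A U U' : Set ZFSet.{u}} (hU : RankUniv U) (hU' : RankUniv U') (h : U ⊆ U')
    {g f X a : ZFSet.{u}} (hs : Success A U g f X a) : Success A U' g f X a := by
  obtain ⟨Y, hY, j, hj, hl, ha⟩ := hs
  exact ⟨Y, h hY, j, h hj, (level_congr hU hU' hY (h hY)).1 hl, ha⟩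

theorem Fails.anti {A U U' : Set ZFSet.{u}} (hU : RankUniv U) (hU' : RankUniv U') (h : U ⊆ U')
    {g f X a : ZFSet.{u}} (hX : X ∈ U) (hs : Fails A U' g f X a) : Fails A U g f X a := by
  obtain ⟨h1, h2, h3, h4, h5, h6⟩ := hs
  exact ⟨(level_congr hU hU' hX (h hX)).2 h1, h2, h3, h4, h5, fun hs => h6 (hs.mono hU hU' h)⟩

theorem exists_isSuccLimit_gt (o : Ordinal.{u}) : ∃ μ, IsSuccLimit μ ∧ o < μ :=
  ⟨o + Ordinal.omega0, Ordinal.isSuccLimit_add _ Ordinal.isSuccLimit_omega0,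
    lt_add_of_pos_right _ Ordinal.omega0_pos⟩

namespace IsExtendible
variable {A : Set ZFSet.{u}} {κ : Ordinal.{u}} (h : IsExtendible A κ)
include h

theorem isSuccLimit : IsSuccLimit κ := by
  obtain ⟨μ, hμ, hκ⟩ := exists_isSuccLimit_gt κ
  obtain ⟨θ, J, hJ⟩ := h.exists_critMap hμ hκ
  exact hJ.isSuccLimit_crit

theorem omega0_lt : Ordinal.omega0 < κ := by
  obtain ⟨μ, hμ, hκ⟩ := exists_isSuccLimit_gt κ
  obtain ⟨θ, J, hJ⟩ := h.exists_critMap hμ hκ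
  exact hJ.omega0_lt_crit

/-- With a degree above the ranks of `Y` and `j`, both witnesses lie in `J (V_ κ)`. The parameters
are fixed by `J`, so elementarity pulls the success back to `V_κ`. -/
theorem success_of_success_univ {g f X a : ZFSet.{u}} (hg : g ∈ V_ κ) (hf : f ∈ V_ κ)
    (hX : X ∈ V_ κ) (ha : a ∈ V_ κ) (hs : Success A Set.univ g f X a) :
    Success A (V_ κ) g f X a := by
  obtain ⟨Y, -, j, -, hl, hA⟩ := hs
  obtain ⟨μ, hμ, hlt⟩ := exists_isSuccLimit_gt (max κ (max Y.rank j.rank))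
  obtain ⟨θ, J, hJ⟩ := h.exists_critMap hμ ((le_max_left _ _).trans_lt hlt)
  obtain ⟨κ', hκ', hμκ', _⟩ := hJ.exists_map_vonNeumann
  have hsub : V_ μ ⊆ V_ κ' := ZFSet.vonNeumann_subset_of_le hμκ'.le
  have hY : Y ∈ V_ μ := ZFSet.mem_vonNeumann.2
    (((le_max_left _ _).trans (le_max_right _ _)).trans_lt hlt)
  have hj : j ∈ V_ μ := ZFSet.mem_vonNeumann.2
    (((le_max_right _ _).trans (le_max_right _ _)).trans_lt hlt)
  have hU := rankUniv_of_isSuccLimit hμ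
  have hκ'l := hJ.isSuccLimit_of_map_eq hκ'
  have hs' : Success A (V_ κ') g f X a := ⟨Y, hsub hY, j, hsub hj,
    (level_congr rankUniv_univ (rankUniv_of_isSuccLimit hκ'l) trivial (hsub hY)).1 hl, hA⟩
  have hκV := ZFSet.vonNeumann_mem_of_lt hJ.lt
  have hm : ∀ {x}, x ∈ V_ κ → x ∈ V_ μ := fun hx => hU.trans hκV hx
  rw [hJ.transfer₆ (fun _ K g f X a _ => Success A K g f X a) hκV (hm hg) (hm hf) (hm hX) (hm ha)
    (hm ha), hκ', hJ.fix hg, hJ.fix hf, hJ.fix hX, hJ.fix ha]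
  exact hs'

end IsExtendible

/-! ### The recursion step -/

/-- `X` is the least level at which something fails. -/
def LeastFails (A U : Set ZFSet.{u}) (g f X : ZFSet.{u}) : Prop :=
  (∃ a ∈ U, Fails A U g f X a) ∧ ∀ X' ∈ U, ∀ a ∈ U, Fails A U g f X' a → X ⊆ X'

/-- The recursion step: `y` is the set chosen by (the graph of) `G` among those that fail at the
least possible level, if there are any. -/
def StepRel (A G U : Set ZFSet.{u}) (g f y : ZFSet.{u}) : Prop :=
  (∃ X ∈ U, LeastFails A U g f X ∧
    ∃ T ∈ U, (∀ a ∈ U, a ∈ T ↔ Fails A U g f X a) ∧ ∃ p ∈ U, p = ZFSet.pair T y ∧ p ∈ G) ∨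
  ((¬ ∃ X ∈ U, ∃ a ∈ U, Fails A U g f X a) ∧ y = ∅)

section
variable {ι : Type v} {cl : ι → Set ZFSet.{u}}

instance FDef.leastFails (cA : ι) (B : Set ZFSet.{u} → (ℕ → ZFSet.{u}) → Set ZFSet.{u})
    [hB : IsBound B] (i k l : ℕ) :
    FDef cl fun U v => LeastFails (cl cA) (B U v) (v i) (v k) (v l) := by
  obtain rfl | ⟨r, rfl⟩ := hB.out <;> unfold LeastFails <;> infer_instance

instance FDef.stepRel (cA cG : ι) (i k l : ℕ) :
    FDef cl fun U v => StepRel (cl cA) (cl cG) U (v i) (v k) (v l) := by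
  unfold StepRel; infer_instance
end


instance FDef.leastFails_const (A : Set ZFSet.{u})
    (B : Set ZFSet.{u} → (ℕ → ZFSet.{u}) → Set ZFSet.{u}) [IsBound B] (i k l : ℕ) :
    FDef (fun _ : Unit => A) fun U v => LeastFails A (B U v) (v i) (v k) (v l) :=
  FDef.leastFails (cl := fun _ : Unit => A) () B i k l

theorem Fails.mem_level {A U : Set ZFSet.{u}} {g f X a : ZFSet.{u}} (h : Fails A U g f X a) :
    g ∈ X ∧ f ∈ X ∧ a ∈ X := ⟨h.2.2.1, h.2.2.2.1, h.2.2.2.2.1⟩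

theorem exists_leastFails {A : Set ZFSet.{u}} {g f X a : ZFSet.{u}}
    (h : Fails A Set.univ g f X a) : ∃ X, LeastFails A Set.univ g f X := by
  obtain ⟨r, ⟨X, a, h, hr⟩, hmin⟩ := WellFounded.has_min (wellFounded_lt (α := Ordinal.{u}))
    {r | ∃ X a, Fails A Set.univ g f X a ∧ X.rank = r} ⟨_, X, a, h, rfl⟩
  refine ⟨X, ⟨a, trivial, h⟩, fun X' _ a' _ h' => ?_⟩
  rw [(level_iff rankUniv_univ trivial).1 h.1, (level_iff rankUniv_univ trivial).1 h'.1,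
    ZFSet.vonNeumann_subset_vonNeumann_iff, hr]
  exact not_lt.1 (hmin X'.rank ⟨X', a', h', rfl⟩)

theorem LeastFails.unique {A : Set ZFSet.{u}} {g f X X' : ZFSet.{u}}
    (h : LeastFails A Set.univ g f X) (h' : LeastFails A Set.univ g f X') : X = X' := by
  obtain ⟨⟨a, _, ha⟩, hm⟩ := h
  obtain ⟨⟨a', _, ha'⟩, hm'⟩ := h'
  have h1 := hm X' trivial a' trivial ha'
  have h2 := hm' X trivial a trivial ha
  ext z
  exact ⟨fun h => h1 h, fun h => h2 h⟩

section step
variable {A : Set ZFSet.{u}} {F : ZFSet.{u} → ZFSet.{u}}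

theorem exists_stepRel (A : Set ZFSet.{u}) (F : ZFSet.{u} → ZFSet.{u}) (g f : ZFSet.{u}) :
    ∃ y, StepRel A (graphV F) Set.univ g f y := by
  by_cases h : ∃ X a, Fails A Set.univ g f X a
  · obtain ⟨X, a, h⟩ := h
    obtain ⟨X, hX⟩ := exists_leastFails h
    let T := X.sep fun a => Fails A Set.univ g f X a
    refine ⟨F T, .inl ⟨X, trivial, hX, T, trivial, fun a _ => ?_, _, trivial, rfl, T, rfl⟩⟩
    rw [ZFSet.mem_sep]
    exact and_iff_right_of_imp fun h => h.mem_level.2.2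
  · exact ⟨∅, .inr ⟨fun ⟨X, _, a, _, hf⟩ => h ⟨X, a, hf⟩, rfl⟩⟩

theorem StepRel.unique {g f y y' : ZFSet.{u}} (h : StepRel A (graphV F) Set.univ g f y)
    (h' : StepRel A (graphV F) Set.univ g f y') : y = y' := by
  rcases h with ⟨X, _, hX, T, _, hT, _, _, rfl, x, hx⟩ | ⟨h, rfl⟩ <;>
    rcases h' with ⟨X', _, hX', T', _, hT', _, _, rfl, x', hx'⟩ | ⟨h', rfl⟩
  · obtain rfl := hX.unique hX'
    have : T = T' := by
      ext a
      rw [hT a trivial, hT' a trivial]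
    subst this
    obtain ⟨rfl, rfl⟩ := ZFSet.pair_inj.1 hx
    obtain ⟨h, rfl⟩ := ZFSet.pair_inj.1 hx'
    rw [h]
  · obtain ⟨a, _, ha⟩ := hX.1
    exact absurd ⟨X, trivial, a, trivial, ha⟩ h'
  · obtain ⟨a, _, ha⟩ := hX'.1
    exact absurd ⟨X', trivial, a, trivial, ha⟩ h
  · rfl

theorem StepRel.fails (hF : ∀ x : ZFSet.{u}, x.Nonempty → F x ∈ x) {g f y : ZFSet.{u}}
    (h : StepRel A (graphV F) Set.univ g f y) {X a : ZFSet.{u}} (hX : Fails A Set.univ g f X a) :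
    ∃ X, LeastFails A Set.univ g f X ∧ Fails A Set.univ g f X y := by
  rcases h with ⟨X, _, hX, T, _, hT, _, _, rfl, x, hx⟩ | ⟨h, rfl⟩
  · obtain ⟨rfl, rfl⟩ := ZFSet.pair_inj.1 hx
    obtain ⟨a, _, ha⟩ := hX.1
    -- `T` is nonempty because something fails at the least level, so the choice function selects a
    -- failure.
    exact ⟨X, hX, (hT _ trivial).1 (hF _ ⟨a, (hT a trivial).2 ha⟩)⟩
  · exact absurd ⟨X, trivial, a, trivial, hX⟩ h

end step

/-! ### Restrictions of the function and their images -/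

theorem mem_restrict {L : Ordinal.{u} → ZFSet.{u}} {κ : Ordinal.{u}} {p : ZFSet.{u}} :
    p ∈ restrict L κ ↔ ∃ b < κ, p = ZFSet.pair b.toZFSet (L b) := by
  rw [restrict, ZFSet.mem_range]
  exact ⟨fun ⟨b, hb⟩ => ⟨b.1, b.2, hb.symm⟩, fun ⟨b, hb, h⟩ => ⟨⟨b, hb⟩, h.symm⟩⟩

theorem pair_mem_restrict {L : Ordinal.{u} → ZFSet.{u}} {κ b : Ordinal.{u}} (hb : b < κ)
    {y : ZFSet.{u}} : ZFSet.pair b.toZFSet y ∈ restrict L κ ↔ y = L b := by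
  rw [mem_restrict]
  constructor
  · rintro ⟨c, _, h⟩
    obtain ⟨h1, rfl⟩ := ZFSet.pair_inj.1 h
    rw [Ordinal.toZFSet_injective h1]
  · rintro rfl
    exact ⟨b, hb, rfl⟩

theorem restrict_subset {L : Ordinal.{u} → ZFSet.{u}} {κ γ : Ordinal.{u}} (hκ : IsSuccLimit κ)
    (hγ : γ ≤ κ) (hL : ∀ b < γ, L b ∈ V_ κ) : restrict L γ ⊆ V_ κ := by
  intro p hp
  obtain ⟨b, hb, rfl⟩ := mem_restrict.1 hp
  exact (rankUniv_of_isSuccLimit hκ).pair (toZFSet_mem_vonNeumann.2 (hb.trans_le hγ)) (hL b hb)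

theorem mem_vonNeumann_of_subset_of_lt {x : ZFSet.{u}} {a b : Ordinal.{u}} (h : x ⊆ V_ a)
    (hab : a < b) : x ∈ V_ b :=
  ZFSet.mem_vonNeumann'.2 ⟨a, hab, h⟩

/-- Both `b` and `L b` lie in `V_κ` and are fixed, so the image takes the same value at `b`. The
case `γ = κ` is the one used for `J (L ↾ κ)`. -/
theorem CritMap.pair_mem_map_restrict {A : Set ZFSet.{u}} {κ μ θ : Ordinal.{u}}
    {J : ZFSet.{u} → ZFSet.{u}} (hJ : CritMap A κ μ θ J) {L : Ordinal.{u} → ZFSet.{u}}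
    {γ b : Ordinal.{u}} (hγ : γ ≤ κ) (hL : ∀ b < γ, L b ∈ V_ κ) (hb : b < γ) {y : ZFSet.{u}}
    (hy : y ∈ V_ θ) : ZFSet.pair b.toZFSet y ∈ J (restrict L γ) ↔ y = L b := by
  have hbκ := toZFSet_mem_vonNeumann.2 (hb.trans_le hγ)
  have hR : restrict L γ ∈ V_ μ :=
    mem_vonNeumann_of_subset_of_lt (restrict_subset hJ.isSuccLimit_crit hγ hL) hJ.lt
  have hm : ∀ x ∈ V_ κ, x ∈ V_ μ := fun x hx => ZFSet.vonNeumann_subset_of_le hJ.lt.le hx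
  have h : ∀ z ∈ (V_ μ : Set ZFSet.{u}), ZFSet.pair b.toZFSet z ∈ restrict L γ ↔ z = L b :=
    fun z _ => pair_mem_restrict hb
  rw [hJ.transfer₃ (fun U g b x => ∀ z ∈ U, ZFSet.pair b z ∈ g ↔ z = x) hR (hm _ hbκ)
    (hm _ (hL b hb)), hJ.fix hbκ, hJ.fix (hL b hb)] at h
  exact h y hy

/-! ### The Laver property at an extendible cardinal -/

namespace IsExtendible
variable {A : Set ZFSet.{u}} {κ : Ordinal.{u}} (h : IsExtendible A κ)
include h

theorem fails_iff {g f X a : ZFSet.{u}} (hg : g ∈ V_ κ) (hf : f ∈ V_ κ)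
    (hX : X ∈ V_ κ) (ha : a ∈ V_ κ) : Fails A (V_ κ) g f X a ↔ Fails A Set.univ g f X a := by
  have hU := rankUniv_of_isSuccLimit h.isSuccLimit
  refine ⟨fun hfl => ?_, fun hfl => hfl.anti hU rankUniv_univ (Set.subset_univ _) hX⟩
  obtain ⟨h1, h2, h3, h4, h5, h6⟩ := hfl
  exact ⟨(level_congr hU rankUniv_univ hX trivial).1 h1, h2, h3, h4, h5,
    fun hs => h6 (h.success_of_success_univ hg hf hX ha hs)⟩

/-- Dual to the reflection of success: a degree above the rank of `X` puts the failure inside `J (V_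
κ)`, and it is pulled back along the fixed parameters. -/
theorem exists_fails_mem {g f X a : ZFSet.{u}} (hg : g ∈ V_ κ) (hf : f ∈ V_ κ)
    (hfl : Fails A Set.univ g f X a) :
    ∃ X ∈ V_ κ, ∃ a ∈ V_ κ, Fails A Set.univ g f X a := by
  obtain ⟨μ, hμ, hlt⟩ := exists_isSuccLimit_gt (max κ X.rank)
  obtain ⟨θ, J, hJ⟩ := h.exists_critMap hμ ((le_max_left _ _).trans_lt hlt)
  obtain ⟨κ', hκ', hμκ', _⟩ := hJ.exists_map_vonNeumann
  have hX : X ∈ V_ κ' := ZFSet.mem_vonNeumann.2 (((le_max_right _ _).trans_lt hlt).trans hμκ')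
  have hU' := rankUniv_of_isSuccLimit (hJ.isSuccLimit_of_map_eq hκ')
  have hκV := ZFSet.vonNeumann_mem_of_lt hJ.lt
  have hm : ∀ {x}, x ∈ V_ κ → x ∈ V_ μ := fun hx => ZFSet.vonNeumann_subset_of_le hJ.lt.le hx
  have key : ∃ X ∈ V_ κ, ∃ a ∈ V_ κ, Fails A (V_ κ) g f X a := by
    rw [hJ.transfer₃ (fun _ K g f => ∃ X ∈ K, ∃ a ∈ K, Fails A K g f X a) hκV (hm hg) (hm hf),
      hκ', hJ.fix hg, hJ.fix hf]
    exact ⟨X, hX, a, hU'.trans hX hfl.mem_level.2.2,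
      hfl.anti hU' rankUniv_univ (Set.subset_univ _) hX⟩
  obtain ⟨X, hX, a, ha, hfl⟩ := key
  exact ⟨X, hX, a, ha, (h.fails_iff hg hf hX ha).1 hfl⟩

section laver
variable {F : ZFSet.{u} → ZFSet.{u}} (hF : ∀ x : ZFSet.{u}, x.Nonempty → F x ∈ x)
  {L : Ordinal.{u} → ZFSet.{u}}
  (hL : ∀ γ, StepRel A (graphV F) Set.univ γ.toZFSet (restrict L γ) (L γ))

/-- This replaces the regularity of `κ`. Since `γ` is fixed, no new arguments appear in the image,
so `J` fixes `restrict L γ`; as an element of `V_μ ⊆ J (V_ κ)` it then belongs to `V_κ`. -/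
theorem restrict_mem {γ : Ordinal.{u}} (hγ : γ < κ) (hV : ∀ b < γ, L b ∈ V_ κ) :
    restrict L γ ∈ V_ κ := by
  obtain ⟨μ, hμ, hlt⟩ := exists_isSuccLimit_gt κ
  obtain ⟨θ, J, hJ⟩ := h.exists_critMap hμ hlt
  obtain ⟨κ', hκ', hμκ', _⟩ := hJ.exists_map_vonNeumann
  have hm : ∀ x ∈ V_ κ, x ∈ V_ μ := fun x hx => ZFSet.vonNeumann_subset_of_le hJ.lt.le hx
  have hsub := restrict_subset h.isSuccLimit hγ.le hV
  have hR : restrict L γ ∈ V_ μ := mem_vonNeumann_of_subset_of_lt hsub hJ.lt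
  have hγV := toZFSet_mem_vonNeumann.2 hγ
  have h1 : ∀ p ∈ restrict L γ, ∃ b ∈ γ.toZFSet, ∃ y ∈ (V_ μ : Set ZFSet.{u}),
      p = ZFSet.pair b y := by
    intro p hp
    obtain ⟨b, hb, rfl⟩ := mem_restrict.1 hp
    exact ⟨_, Ordinal.toZFSet_mem_toZFSet_iff.2 hb, _, hm _ (hV b hb), rfl⟩
  rw [hJ.transfer₂ (fun U g c => ∀ p ∈ g, ∃ b ∈ c, ∃ y ∈ U, p = ZFSet.pair b y) hR (hm _ hγV),
    hJ.fix hγV] at h1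
  have hfix : J (restrict L γ) = restrict L γ := by
    ext p
    constructor
    · intro hp
      obtain ⟨_, hb', y, hy, rfl⟩ := h1 p hp
      obtain ⟨b, hb, rfl⟩ := Ordinal.mem_toZFSet_iff.1 hb'
      exact (pair_mem_restrict hb).2 ((hJ.pair_mem_map_restrict hγ.le hV hb hy).1 hp)
    · intro hp
      have := (hJ.mem_iff (hm p (hsub hp)) hR).1 hp
      rwa [hJ.fix (hsub hp)] at this
  rw [hJ.mem_iff hR (ZFSet.vonNeumann_mem_of_lt hJ.lt), hfix, hκ']
  exact ZFSet.vonNeumann_subset_of_le hμκ'.le hR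

include hF hL

/-- Failures reflect to some level in `V_κ`; the least failing level is included in it, and the
chosen value is an element of the latter. -/
theorem laver_mem {γ : Ordinal.{u}} (hγ : γ < κ) : L γ ∈ V_ κ := by
  induction γ using WellFoundedLT.induction with
  | _ γ ih =>
  have hU := rankUniv_of_isSuccLimit h.isSuccLimit
  have hR := h.restrict_mem hγ fun b hb => ih b hb (hb.trans hγ)
  have hγV := toZFSet_mem_vonNeumann.2 hγ
  by_cases hfl : ∃ X a, Fails A Set.univ γ.toZFSet (restrict L γ) X a
  · obtain ⟨X, a, hfl⟩ := hfl
    obtain ⟨X₀, hX₀, hfl₀⟩ := (hL γ).fails hF hfl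
    obtain ⟨X₁, hX₁, a₁, _, hfl₁⟩ := h.exists_fails_mem hγV hR hfl
    exact hU.trans hX₁ (hX₀.2 X₁ trivial a₁ trivial hfl₁ hfl₀.mem_level.2.2)
  · rcases hL γ with ⟨X, _, ⟨⟨a, _, ha⟩, _⟩, _⟩ | ⟨_, h0⟩
    · exact absurd ⟨X, a, ha⟩ hfl
    · rw [h0]
      exact hU.subset hR (ZFSet.empty_subset _)

/-- Below `κ`, the values of `L` are least failures in the sense of `V_κ`. -/
theorem laver_spec : ∀ γ ∈ κ.toZFSet, ∀ g ∈ V_ κ,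
    (∀ p ∈ V_ κ, p ∈ g ↔ p ∈ restrict L κ ∧ ∃ b ∈ γ, ∃ y ∈ V_ κ, p = ZFSet.pair b y) →
    (∃ X ∈ V_ κ, ∃ a ∈ V_ κ, Fails A (V_ κ) γ g X a) →
    ∃ X ∈ V_ κ, LeastFails A (V_ κ) γ g X ∧ ∃ a ∈ V_ κ, Fails A (V_ κ) γ g X a ∧
      ZFSet.pair γ a ∈ restrict L κ := by
  have hU := rankUniv_of_isSuccLimit h.isSuccLimit
  have hmem := fun γ => h.laver_mem hF hL (γ := γ)
  intro _ hγ' g hg hp hfl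
  obtain ⟨γ, hγ, rfl⟩ := Ordinal.mem_toZFSet_iff.1 hγ'
  have hγV := toZFSet_mem_vonNeumann.2 hγ
  -- The hypothesis on `g` is the internal description of `L ↾ γ`, in a form that elementarity can
  -- move.
  obtain rfl : g = restrict L γ := by
    have hV := restrict_subset h.isSuccLimit hγ.le fun b hb => hmem b (hb.trans hγ)
    have key : ∀ p ∈ V_ κ, p ∈ g ↔ p ∈ restrict L γ := by
      intro p hpV
      rw [hp p hpV]
      constructor
      · rintro ⟨h1, _, hb', y, _, rfl⟩
        obtain ⟨b, hb, rfl⟩ := Ordinal.mem_toZFSet_iff.1 hb'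
        rw [pair_mem_restrict (hb.trans hγ)] at h1
        exact (pair_mem_restrict hb).2 h1
      · intro h1
        obtain ⟨b, hb, rfl⟩ := mem_restrict.1 h1
        exact ⟨(pair_mem_restrict (hb.trans hγ)).2 rfl, _,
          Ordinal.toZFSet_mem_toZFSet_iff.2 hb, _, hmem b (hb.trans hγ), rfl⟩
    ext p
    exact ⟨fun h1 => (key p (hU.trans hg h1)).1 h1, fun h1 => (key p (hV h1)).2 h1⟩
  obtain ⟨X, hX, a, ha, hfl⟩ := hfl
  have hfl' := (h.fails_iff hγV hg hX ha).1 hfl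
  obtain ⟨X₀, hX₀, hfl₀⟩ := (hL γ).fails hF hfl'
  have hX₀V : X₀ ∈ V_ κ := hU.subset hX (hX₀.2 X trivial a trivial hfl')
  have hflV := (h.fails_iff hγV hg hX₀V (hmem γ hγ)).2 hfl₀
  refine ⟨X₀, hX₀V, ⟨⟨L γ, hmem γ hγ, hflV⟩, fun X' hX' a' ha' h' => ?_⟩, L γ, hmem γ hγ, hflV,
    (pair_mem_restrict hγ).2 rfl⟩
  exact hX₀.2 X' trivial a' trivial ((h.fails_iff hγV hg hX' ha').1 h')

theorem isFunc_restrict : ZFSet.IsFunc κ.toZFSet (V_ κ) (restrict L κ) := by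
  constructor
  · intro p hp
    obtain ⟨b, hb, rfl⟩ := mem_restrict.1 hp
    exact ZFSet.pair_mem_prod.2 ⟨Ordinal.toZFSet_mem_toZFSet_iff.2 hb, h.laver_mem hF hL hb⟩
  · intro z hz
    obtain ⟨b, hb, rfl⟩ := Ordinal.mem_toZFSet_iff.1 hz
    exact ⟨L b, (pair_mem_restrict hb).2 rfl, fun y hy => (pair_mem_restrict hb).1 hy⟩

/-- The core contradiction: the value of `J (L ↾ κ)` at `κ` fails by construction, yet `J` itself
anticipates it. -/
theorem not_fails {ρ : Ordinal.{u}} (hκρ : κ < ρ) {a : ZFSet.{u}} :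
    ¬ Fails A Set.univ κ.toZFSet (restrict L κ) (V_ ρ) a := by
  intro hfl
  obtain ⟨μ, hμ, hlt⟩ := exists_isSuccLimit_gt ρ
  obtain ⟨θ, J, hJ⟩ := h.exists_critMap hμ (hκρ.trans hlt)
  obtain ⟨κ', hκ', hμκ', hκ'θ⟩ := hJ.exists_map_vonNeumann
  have hmem := fun γ => h.laver_mem hF hL (γ := γ)
  have hU := rankUniv_of_isSuccLimit hμ
  have hUθ := rankUniv_of_isSuccLimit (hJ.isSuccLimit hμ)
  have hU' := rankUniv_of_isSuccLimit (hJ.isSuccLimit_of_map_eq hκ')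
  have hκV := ZFSet.vonNeumann_mem_of_lt hJ.lt
  have hκμ := toZFSet_mem_vonNeumann.2 hJ.lt
  have hm : ∀ {x}, x ∈ V_ κ → x ∈ V_ μ := fun hx => hU.trans hκV hx
  have hsub : restrict L κ ⊆ V_ κ := restrict_subset h.isSuccLimit le_rfl hmem
  have hf : restrict L κ ∈ V_ μ := mem_vonNeumann_of_subset_of_lt hsub hJ.lt
  have hμκ : ∀ {x}, x ∈ V_ μ → x ∈ V_ κ' := fun hx => ZFSet.vonNeumann_subset_of_le hμκ'.le hx
  have hκ'sub : ∀ {x}, x ∈ V_ κ' → x ∈ V_ θ := fun hx =>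
    ZFSet.vonNeumann_subset_of_le hκ'θ.le hx
  have hspec := h.laver_spec hF hL
  rw [hJ.transfer₃ (fun _ K c f => ∀ γ ∈ c, ∀ g ∈ K,
      (∀ p ∈ K, p ∈ g ↔ p ∈ f ∧ ∃ b ∈ γ, ∃ y ∈ K, p = ZFSet.pair b y) →
      (∃ X ∈ K, ∃ a ∈ K, Fails A K γ g X a) →
      ∃ X ∈ K, LeastFails A K γ g X ∧ ∃ a ∈ K, Fails A K γ g X a ∧ ZFSet.pair γ a ∈ f)
    hκV hκμ hf, hκ'] at hspec
  have hκJ : κ.toZFSet ∈ J κ.toZFSet := hJ.mem_of_lt hJ.lt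
  have hVρ : V_ ρ ∈ V_ κ' := ZFSet.vonNeumann_mem_of_lt (hlt.trans hμκ')
  have hfl' : Fails A (V_ κ') κ.toZFSet (restrict L κ) (V_ ρ) a :=
    hfl.anti hU' rankUniv_univ (Set.subset_univ _) hVρ
  have haκ' : a ∈ V_ κ' := hU'.trans hVρ hfl.mem_level.2.2
  -- The image statement is used at `κ ∈ J κ` with `L ↾ κ`, the part of `J (L ↾ κ)` below `κ`.
  obtain ⟨X, hX, ⟨_, hmin⟩, b, hb, hflX, hval⟩ := hspec _ hκJ _ (hμκ hf) (by
    intro p hp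
    constructor
    · intro h1
      have h2 := (hJ.mem_iff (hm (hsub h1)) hf).1 h1
      rw [hJ.fix (hsub h1)] at h2
      obtain ⟨c, hc, rfl⟩ := mem_restrict.1 h1
      exact ⟨h2, _, Ordinal.toZFSet_mem_toZFSet_iff.2 hc, _, hμκ (hm (hmem c hc)), rfl⟩
    · rintro ⟨h1, _, hc', y, hy, rfl⟩
      obtain ⟨c, hc, rfl⟩ := Ordinal.mem_toZFSet_iff.1 hc'
      rw [hJ.pair_mem_map_restrict le_rfl hmem hc (hκ'sub hy)] at h1
      exact (pair_mem_restrict hc).2 h1) ⟨_, hVρ, a, haκ', hfl'⟩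
  -- Minimality keeps the failing level within `V_ρ`, hence inside the domain `V_μ` of `J`.
  have hXρ : X ⊆ V_ ρ := hmin _ hVρ a haκ' hfl'
  have hXV := (level_iff hU' hX).1 hflX.1
  generalize X.rank = ρ' at hXV
  subst hXV
  have hρ'ρ : ρ' ≤ ρ := ZFSet.vonNeumann_subset_vonNeumann_iff.1 hXρ
  have hκρ' : κ < ρ' := toZFSet_mem_vonNeumann.1 hflX.mem_level.1
  have hρ' : IsSuccLimit ρ' := isSuccLimit_of_noMax (zero_le.trans_lt hκρ') hflX.2.1
  have hρ'μ := hρ'ρ.trans_lt hlt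
  obtain ⟨j, hj, hant⟩ := hJ.exists_anticipates hρ' hρ'μ hκρ' hflX.mem_level.2.1 hval
  have hJX := hJ.maps _ (ZFSet.vonNeumann_mem_of_lt hρ'μ)
  have hs : Success A (V_ θ) κ.toZFSet (restrict L κ) (V_ ρ') b := by
    refine ⟨_, hJX, j, hj, (level_iff hUθ hJX).2 ?_, hant⟩
    rw [hJ.map_vonNeumann hμ hρ'μ, ZFSet.rank_vonNeumann]
  -- The success was found in `V_θ`, the failure in `V_κ'`. The image under `J` of reflection from
  -- `V_μ` to `V_κ` bridges the gap.
  have hrefl : ∀ g ∈ V_ κ, ∀ f ∈ V_ κ, ∀ X ∈ V_ κ, ∀ a ∈ V_ κ,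
      Success A (V_ μ) g f X a → Success A (V_ κ) g f X a := fun g hg f hf X hX a ha hs =>
    h.success_of_success_univ hg hf hX ha (hs.mono hU rankUniv_univ (Set.subset_univ _))
  rw [hJ.transfer₁ (fun U K => ∀ g ∈ K, ∀ f ∈ K, ∀ X ∈ K, ∀ a ∈ K,
    Success A U g f X a → Success A K g f X a) hκV, hκ'] at hrefl
  exact hflX.2.2.2.2.2 (hrefl _ (hμκ hκμ) _ (hμκ hf) _ hX _ hb hs)

theorem isLaver_restrict : IsLaver A κ (restrict L κ) := by
  refine ⟨h.isFunc_restrict hF hL, fun l hl a => ?_⟩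
  -- A limit strictly above `l` leaves room in `V_ρ` for the sets coding satisfaction in `V_l`.
  obtain ⟨ρ, hρ, hlt⟩ := exists_isSuccLimit_gt (max l a.rank)
  have hlρ := (le_max_left _ _).trans_lt hlt
  have hf : restrict L κ ∈ V_ l := mem_vonNeumann_of_subset_of_lt
    (restrict_subset h.isSuccLimit le_rfl fun b hb => h.laver_mem hF hL hb) hl
  by_contra hno
  refine h.not_fails hF hL (hl.trans hlρ) (a := a) ⟨?_, noMax_of_isSuccLimit hρ,
    toZFSet_mem_vonNeumann.2 (hl.trans hlρ), ZFSet.vonNeumann_subset_of_le hlρ.le hf,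
    ZFSet.mem_vonNeumann.2 ((le_max_right _ _).trans_lt hlt), ?_⟩
  · rw [level_iff rankUniv_univ trivial, ZFSet.rank_vonNeumann]
  · rintro ⟨Y, -, j, -, hY, hant⟩
    exact hno (hant.exists_isExtEmb h.omega0_lt hl hlρ hρ
      ⟨_, (level_iff rankUniv_univ trivial).1 hY⟩ hf)

end laver
end IsExtendible

/-! ### Solving the recursion and defining its graph -/

/-- The function on the ordinals defined by the recursion step `S`. -/
noncomputable def recOrd (S : ZFSet.{u} → ZFSet.{u} → ZFSet.{u}) (γ : Ordinal.{u}) : ZFSet.{u} :=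
  S γ.toZFSet (ZFSet.range fun α : Set.Iio γ => ZFSet.pair α.1.toZFSet (recOrd S α.1))
termination_by γ
decreasing_by exact α.2

theorem recOrd_eq (S : ZFSet.{u} → ZFSet.{u} → ZFSet.{u}) (γ : Ordinal.{u}) :
    recOrd S γ = S γ.toZFSet (restrict (recOrd S) γ) := by
  rw [recOrd, restrict]

/-- The step function comes from an arbitrary choice, which does no harm to definability: `StepRel`
has only one value. -/
theorem exists_laver (A : Set ZFSet.{u}) (F : ZFSet.{u} → ZFSet.{u}) :
    ∃ L : Ordinal.{u} → ZFSet.{u},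
      ∀ γ, StepRel A (graphV F) Set.univ γ.toZFSet (restrict L γ) (L γ) := by
  choose S hS using exists_stepRel A F
  exact ⟨recOrd S, fun γ => by rw [recOrd_eq]; exact hS _ _⟩

/-- `h` is the restriction of `g` to `d`. -/
def IsRestrict (U : Set ZFSet.{u}) (d g h : ZFSet.{u}) : Prop :=
  ∀ r ∈ U, r ∈ h ↔ r ∈ g ∧ ∃ e ∈ d, ∃ z ∈ U, r = ZFSet.pair e z

/-- `g` is the function with domain `c` given by the recursion `StepRel`. -/
def IsApprox (A G U : Set ZFSet.{u}) (c g : ZFSet.{u}) : Prop :=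
  ∀ q ∈ U, q ∈ g ↔ ∃ d ∈ c, ∃ h ∈ U, ∃ y ∈ U, q = ZFSet.pair d y ∧ IsRestrict U d g h ∧
    StepRel A G U d h y

/-- `p` is in the graph of the function given by the recursion `StepRel`. -/
def InGraph (A G U : Set ZFSet.{u}) (p : ZFSet.{u}) : Prop :=
  ∃ c ∈ U, c.IsOrdinal ∧ ∃ g ∈ U, IsApprox A G U c g ∧
    ∃ y ∈ U, p = ZFSet.pair c y ∧ StepRel A G U c g y

instance FDef.inGraph {ι : Type v} {cl : ι → Set ZFSet.{u}} (cA cG : ι) (i : ℕ) :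
    FDef cl fun U v => InGraph (cl cA) (cl cG) U (v i) := by
  unfold InGraph IsApprox IsRestrict; infer_instance

section
variable {A : Set ZFSet.{u}} {F : ZFSet.{u} → ZFSet.{u}} {L : Ordinal.{u} → ZFSet.{u}}
  (hL : ∀ γ, StepRel A (graphV F) Set.univ γ.toZFSet (restrict L γ) (L γ))

theorem isRestrict_iff {b : Ordinal.{u}} {g h : ZFSet.{u}}
    (hg : ∀ c < b, ∀ y, ZFSet.pair c.toZFSet y ∈ g ↔ y = L c) :
    IsRestrict Set.univ b.toZFSet g h ↔ h = restrict L b := by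
  have key : ∀ r, (r ∈ g ∧ ∃ e ∈ b.toZFSet, ∃ z ∈ (Set.univ : Set ZFSet.{u}), r = ZFSet.pair e z) ↔
      r ∈ restrict L b := by
    intro r
    rw [mem_restrict]
    constructor
    · rintro ⟨h1, _, he, z, _, rfl⟩
      obtain ⟨c, hc, rfl⟩ := Ordinal.mem_toZFSet_iff.1 he
      exact ⟨c, hc, by rw [(hg c hc z).1 h1]⟩
    · rintro ⟨c, hc, rfl⟩
      exact ⟨(hg c hc _).2 rfl, _, Ordinal.toZFSet_mem_toZFSet_iff.2 hc, _, trivial, rfl⟩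
  constructor
  · intro H
    ext r
    rw [H r trivial, key]
  · rintro rfl r _
    exact (key r).symm

include hL

theorem stepRel_iff {b : Ordinal.{u}} {y : ZFSet.{u}} :
    StepRel A (graphV F) Set.univ b.toZFSet (restrict L b) y ↔ y = L b :=
  ⟨fun h => h.unique (hL b), by rintro rfl; exact hL b⟩

/-- Induction below `b` forces the values of any approximation to be those of `L`. -/
theorem isApprox_iff {b : Ordinal.{u}} {g : ZFSet.{u}} :
    IsApprox A (graphV F) Set.univ b.toZFSet g ↔ g = restrict L b := by
  constructor
  · intro H
    have key : ∀ c < b, ∀ y, ZFSet.pair c.toZFSet y ∈ g ↔ y = L c := by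
      intro c
      induction c using WellFoundedLT.induction with
      | _ c ih =>
      intro hc y
      have hr : ∀ h, IsRestrict Set.univ c.toZFSet g h ↔ h = restrict L c := fun h =>
        isRestrict_iff fun d hd => ih d hd (hd.trans hc)
      rw [H _ trivial]
      constructor
      · rintro ⟨d, _, h, _, y', _, heq, hh, hs⟩
        obtain ⟨rfl, rfl⟩ := ZFSet.pair_inj.1 heq
        rw [(hr h).1 hh] at hs
        exact (stepRel_iff hL).1 hs
      · rintro rfl
        exact ⟨_, Ordinal.toZFSet_mem_toZFSet_iff.2 hc, _, trivial, _, trivial, rfl, (hr _).2 rfl,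
          hL c⟩
    ext p
    rw [mem_restrict]
    constructor
    · intro hp
      obtain ⟨_, hd, _, _, y, _, rfl, _⟩ := (H p trivial).1 hp
      obtain ⟨c, hc, rfl⟩ := Ordinal.mem_toZFSet_iff.1 hd
      exact ⟨c, hc, by rw [(key c hc y).1 hp]⟩
    · rintro ⟨c, hc, rfl⟩
      exact (key c hc _).2 rfl
  · rintro rfl q _
    have hr : ∀ c < b, ∀ h, IsRestrict Set.univ c.toZFSet (restrict L b) h ↔ h = restrict L c :=
      fun c hc h => isRestrict_iff fun d hd y => pair_mem_restrict (hd.trans hc)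
    rw [mem_restrict]
    constructor
    · rintro ⟨c, hc, rfl⟩
      exact ⟨_, Ordinal.toZFSet_mem_toZFSet_iff.2 hc, _, trivial, _, trivial, rfl,
        (hr c hc _).2 rfl, hL c⟩
    · rintro ⟨_, hd, h, _, y, _, rfl, hh, hs⟩
      obtain ⟨c, hc, rfl⟩ := Ordinal.mem_toZFSet_iff.1 hd
      rw [(hr c hc h).1 hh] at hs
      exact ⟨c, hc, by rw [(stepRel_iff hL).1 hs]⟩

/-- Each `L ↾ b` is a set, so set approximations suffice as witnesses and no quantifier over classes
is needed. -/
theorem mem_graphOrd_iff {p : ZFSet.{u}} :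
    p ∈ graphOrd L ↔ InGraph A (graphV F) Set.univ p := by
  constructor
  · rintro ⟨b, rfl⟩
    exact ⟨_, trivial, ZFSet.isOrdinal_toZFSet b, _, trivial, (isApprox_iff hL).2 rfl, _, trivial,
      rfl, hL b⟩
  · rintro ⟨c, _, hc, g, _, hg, y, _, rfl, hs⟩
    obtain ⟨b, rfl⟩ := ZFSet.isOrdinal_iff_mem_range_toZFSet.1 hc
    rw [(isApprox_iff hL).1 hg] at hs
    exact ⟨b, by rw [(stepRel_iff hL).1 hs]⟩

end

/-! ### Class comprehension and the conclusion -/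

theorem isInterp_classUniv (C : Set (Set ZFSet.{u})) :
    IsInterp (fun c : ↥C => c.1) Set.univ (ClassUniv C) (fun x => x) where
  inj := fun _ _ h => h
  range_eq := Set.range_id
  trans _ _ _ _ := trivial
  mem _ := Iff.rfl
  cls _ _ := Iff.rfl

theorem IsGBC.mem_of_fDef {C : Set (Set ZFSet.{u})} (hC : IsGBC C)
    {P : Set ZFSet.{u} → ZFSet.{u} → Prop}
    (hP : FDef (fun c : ↥C => c.1) fun U v => P U (v 0)) {D : Set ZFSet.{u}}
    (hD : ∀ x, x ∈ D ↔ P Set.univ x) : D ∈ C := by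
  apply hC.comprehension
  obtain ⟨φ, hφ⟩ := hP
  -- Only slot `0` matters, so all variables may be identified with the single free one.
  refine Set.Definable.mono (A := ∅) (Set.empty_definable_iff.2
    ⟨φ.relabel fun _ => (0 : Fin 1), ?_⟩) (Set.empty_subset _)
  ext x
  refine (hD (x 0)).trans ?_
  refine Iff.trans ?_ Formula.realize_relabel.symm
  exact (hφ _ _ _ (isInterp_classUniv C) fun _ => x 0).symm

/-- This makes the theorem for an arbitrary `A` a special case of the class version. -/
theorem isGBC_univ : IsGBC (Set.univ : Set (Set ZFSet.{u})) where
  comprehension _ _ := trivial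
  global_choice := by
    have h (x : ZFSet.{u}) : ∃ y, x.Nonempty → y ∈ x := by
      by_cases hx : x.Nonempty
      · exact hx.imp fun y hy _ => hy
      · exact ⟨∅, fun h => absurd h hx⟩
    choose F hF using h
    exact ⟨F, trivial, hF⟩

theorem IsGBC.exists_laver {C : Set (Set ZFSet.{u})} (hC : IsGBC C) {A : Set ZFSet.{u}}
    (hA : A ∈ C) : ∃ L : Ordinal.{u} → ZFSet.{u}, graphOrd L ∈ C ∧
      ∀ κ : Ordinal.{u}, IsExtendible A κ → IsLaver A κ (restrict L κ) := by
  obtain ⟨F, hFC, hF⟩ := hC.global_choice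
  obtain ⟨L, hL⟩ := AExt.exists_laver A F
  exact ⟨L, hC.mem_of_fDef (FDef.inGraph (cl := fun c : ↥C => c.1) ⟨A, hA⟩ ⟨_, hFC⟩ 0)
    fun _ => mem_graphOrd_iff hL, fun κ h => h.isLaver_restrict hF hL⟩

end AExt

theorem theorem1p3 :
    (∀ (A : Set ZFSet.{u}) (κ : Ordinal.{u}),
      AExt.IsExtendible A κ → ∃ f : ZFSet.{u}, AExt.IsLaver A κ f) ∧
    (∀ C : Set (Set ZFSet.{u}), AExt.IsGBC C → ∀ A ∈ C,
      ∃ L : Ordinal.{u} → ZFSet.{u}, AExt.graphOrd L ∈ C ∧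
        ∀ κ : Ordinal.{u}, AExt.IsExtendible A κ →
          AExt.IsLaver A κ (AExt.restrict L κ)) := by
  refine ⟨fun A κ h => ?_, fun C hC A hA => hC.exists_laver hA⟩
  obtain ⟨L, -, hL⟩ := AExt.isGBC_univ.exists_laver (Set.mem_univ A)
  exact ⟨_, hL κ h⟩
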